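/- **Large deviations of the current of a confined tracer.** Let $\beta_L,\beta_R>0$, $T_L=1/\beta_L$, $T_R=1/\beta_R$. A particle moves in $[0,1]$ between a left wall at $0$ (inverse temperature $\beta_L$) and a right wall at $1$ (inverse temperature $\beta_R$), with initial position $q_0\in[0,1]$ and initial velocity $p_0\neq 0$. Put $\sigma_k=(-1)^k\,\mathrm{sign}(p_0)$ for $k\ge 0$, and $\beta_{+1}=\beta_R$, $\beta_{-1}=\beta_L$. The first collision with a wall happens at time $S_0=\big(\tfrac{\sigma_0+1}{2}-q_0\big)/p_0$. The durations $\tau_1,\tau_2,\dots$ of the successive flights between the walls are independent random variables, $\tau_k$ having density $$\frac{\beta_{\sigma_{k-1}}}{s^3}\exp\Big(-\frac{\beta_{\sigma_{k-1}}}{2s^2}\Big),\qquad s>0.$$ Let $S_k=S_0+\tau_1+\dots+\tau_k$ be the collision times, $v_k=\sigma_k/\tau_k$ ($k\ge1$) the incoming velocities, and $$J[0,t]=\frac12\sum_{k\ge1:\,S_k\le t}v_k^2\,\sigma_k$$ the energy exchanged between the two walls during $[0,t]$. Let $\mu_t$ be the law of $J[0,t]/t$, and set $$j^*=\kappa\,(T_L-T_R),\qquad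 \kappa^{-1}=\Big(\frac{\pi\beta_L}{2}\Big)^{1/2}+\Big(\frac{\pi\beta_R}{2}\Big)^{1/2}.$$ For every $\lambda\in\mathbb R$ the limit $$f(\lambda)=\lim_{t\to\infty}\frac1t\log\mathbb E\big(e^{\lambda J[0,t]}\big)\in(-\infty,+\infty]$$ exists and depends only on $\lambda,\beta_L,\beta_R$ (not on the initial data). Let $I(j)=\sup_{\lambda\in\mathbb R}\{\lambda j-f(\lambda)\}$, $j\in\mathbb R$. Then, for all initial data, $(\mu_t)$ satisfies as $t\to\infty$ the full large deviations principle with speed $t$ and rate function $I$: $I\ge0$ is lower semicontinuous and, for every Borel set $A\subseteq\mathbb R$, $$\limsup_{t\to\infty}\frac1t\log\mu_t(A)\le-\inf_{\overline A}I,\qquad \liminf_{t\to\infty}\frac1t\log\mu_t(A)\ge-\inf_{\mathring A}I .$$ This holds although $I$ is not strictly convex between $-j^*$ and $j^*$ if $\beta_L\ne\beta_R$: $I(j)=0$ for every $j$ between $0$ and $j^*$, and $I(j)=|\beta_R-\beta_L|\,|j|$ for every $j$ between $-j^*$ and $0$. -/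

import Mathlib

open MeasureTheory ProbabilityTheory Filter Topology

universe u

noncomputable section

namespace ConfinedTracer

/-- The law of a flight time `s` after an emission by a wall at inverse temperature `β`:
density `β s⁻³ exp (-β / (2 s²))` on `s > 0`, so that the speed `p = 1 / s` has density
`β p exp (-β p² / 2)` on `p > 0`. -/
def flightLaw (β : ℝ) : Measure ℝ :=
  volume.withDensity fun s =>
    ENNReal.ofReal (if 0 < s then β / s ^ 3 * Real.exp (-β / (2 * s ^ 2)) else 0)

/-- The signs `σ_k = (-1)^k σ_0` of the successive velocities, with `σ_0 = sign p₀`. -/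
def dir (p₀ : ℝ) (k : ℕ) : ℝ := (-1) ^ k * Real.sign p₀

/-- The inverse temperature of the wall towards which a particle with velocity sign `σ` moves:
the right wall (at `1`) for `σ = 1`, the left wall (at `0`) for `σ = -1`. -/
def wallBeta (βL βR σ : ℝ) : ℝ := if 0 < σ then βR else βL

/-- The time `S_0` of the first collision with a wall, from position `q₀` with velocity `p₀`. -/
def firstHit (q₀ p₀ : ℝ) : ℝ := ((dir p₀ 0 + 1) / 2 - q₀) / p₀

/-- The tracer confined in `[0, 1]`, with initial data `(q₀, p₀)`. Here `τ k` is the duration of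
the `(k+1)`-st flight between the walls (it starts at the collision time `S_k`). The flight times
are independent, and `τ k` is distributed according to the temperature of the wall hit at
time `S_k`. -/
structure IsTracer {Ω : Type*} [MeasurableSpace Ω] (P : Measure Ω) (βL βR p₀ : ℝ)
    (τ : ℕ → Ω → ℝ) : Prop where
  indep : iIndepFun τ P
  law : ∀ k, HasLaw (τ k) (flightLaw (wallBeta βL βR (dir p₀ k))) P

/-- The collision times `S_k = S_0 + τ 0 + ⋯ + τ (k-1)`. -/
def hitTime {Ω : Type*} (q₀ p₀ : ℝ) (τ : ℕ → Ω → ℝ) (k : ℕ) (ω : Ω) : ℝ :=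
  firstHit q₀ p₀ + ∑ i ∈ Finset.range k, τ i ω

/-- The velocity `v_k = σ_k / τ_k` with which the particle arrives at the collision time `S_k`,
for `k = n + 1 ≥ 1`. -/
def velocity {Ω : Type*} (p₀ : ℝ) (τ : ℕ → Ω → ℝ) (n : ℕ) (ω : Ω) : ℝ :=
  dir p₀ (n + 1) / τ n ω

/-- The energy exchanged between the walls during `[0, t]`,
`J[0,t] = (1/2) ∑_{k ≥ 1, S_k ≤ t} v_k² σ_k`, with `k = n + 1`. Almost surely the sum has only
finitely many nonzero terms. -/
def current {Ω : Type*} (q₀ p₀ : ℝ) (τ : ℕ → Ω → ℝ) (t : ℝ) (ω : Ω) : ℝ :=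
  (1 / 2) * ∑' n : ℕ,
    if hitTime q₀ p₀ τ (n + 1) ω ≤ t then velocity p₀ τ n ω ^ 2 * dir p₀ (n + 1) else 0

/-- The law of the empirical current `J[0,t] / t`. -/
def currentLaw {Ω : Type*} [MeasurableSpace Ω] (P : Measure Ω) (q₀ p₀ : ℝ) (τ : ℕ → Ω → ℝ)
    (t : ℝ) : Measure ℝ :=
  P.map fun ω => current q₀ p₀ τ t ω / t

/-- `(1/t) log E[exp (lam J[0,t])]`, with values in `[-∞, ∞]`. -/
def scaledCGF {Ω : Type*} [MeasurableSpace Ω] (P : Measure Ω) (q₀ p₀ : ℝ) (τ : ℕ → Ω → ℝ)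
    (lam t : ℝ) : EReal :=
  ENNReal.log (∫⁻ ω, ENNReal.ofReal (Real.exp (lam * current q₀ p₀ τ t ω)) ∂P) / (t : EReal)

/-- The Legendre transform of an extended-real function on the line. -/
def legendre (f : ℝ → EReal) (j : ℝ) : EReal := ⨆ lam : ℝ, ((lam * j : ℝ) : EReal) - f lam

/-- `f` is the cumulant generating function `f(·, βL, βR)` of the current: for every realization of
the tracer and all initial data `(q₀, p₀)`, it is the limit of `(1/t) log E[exp (lam J[0,t])]`
as `t → ∞`. -/
def IsCGF (βL βR : ℝ) (f : ℝ → EReal) : Prop :=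
  ∀ (Ω : Type u) [MeasurableSpace Ω] (P : Measure Ω) [IsProbabilityMeasure P] (q₀ p₀ : ℝ)
    (τ : ℕ → Ω → ℝ), q₀ ∈ Set.Icc (0 : ℝ) 1 → p₀ ≠ 0 → IsTracer P βL βR p₀ τ →
    ∀ lam : ℝ, Tendsto (fun t : ℝ => scaledCGF P q₀ p₀ τ lam t) atTop (𝓝 (f lam))

/-- The full large deviations principle on the line, as `t → ∞`, with speed `t`. -/
structure LargeDeviations (μ : ℝ → Measure ℝ) (I : ℝ → EReal) : Prop where
  nonneg : ∀ x, 0 ≤ I x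
  lsc : LowerSemicontinuous I
  upper : ∀ A : Set ℝ, MeasurableSet A →
    limsup (fun t : ℝ => ENNReal.log (μ t A) / (t : EReal)) atTop ≤ -⨅ x ∈ closure A, I x
  lower : ∀ A : Set ℝ, MeasurableSet A →
    -⨅ x ∈ interior A, I x ≤ liminf (fun t : ℝ => ENNReal.log (μ t A) / (t : EReal)) atTop

/-- The conductivity `κ`. -/
def conductivity (βL βR : ℝ) : ℝ := (√(Real.pi * βL / 2) + √(Real.pi * βR / 2))⁻¹

/-- The mean current `j* = κ (T_L - T_R)`. -/
def meanCurrent (βL βR : ℝ) : ℝ := conductivity βL βR * (1 / βL - 1 / βR)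

end ConfinedTracer

end

noncomputable section

namespace ConfinedTracer


/-! Two consecutive flights, one from each wall, form a cycle; the cycles are independent and
identically distributed, with energy X and duration T. For `lam` in `(-βR, βL)` and `s ≥ 0` the
moment E[exp (lam X - s T)] = exp (`logGen` lam s) is finite, and the limit f(lam) is the least `s ≥
0` with `logGen ≤ 0`. The restriction `s ≥ 0` is essential: a flight outlasts t with probability at
least C / t² (`flightLaw_Ioi_ge`), so wasting time costs nothing on the exponential scale and f
cannot be negative. Hence f vanishes between 0 and βL - βR; it need not be differentiable at these
two points, so the Gärtner–Ellis theorem is not available and the lower bound is built by hand.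

Upper bounds: E exp (lam J) is at most exp (s t) times the sum over N of E exp (lam X_N - s T_N),
X_N and T_N being the energy and duration of the first N flights; this is a geometric series, finite
as soon as s > f(lam) (`IsTracer.exists_lintegral_exp_current_le`). Outside `(-βR, βL)` the moment
is infinite, because one very fast flight suffices. Chernoff's inequality on the two half-lines that
start at the points of the closure nearest to 0 on either side then gives the upper bound for every
set, unbounded ones included.

Lower bounds: run c cycles per unit time under the tilt exp (lam X - s T) with `logGen` = 0, then
spend the remaining time in one long, free flight (`IsTracer.eventually_current_near`). Every
current j ≠ 0 is reached at the cost lam j - f(lam) for a suitable lam (`exists_optimal_tilt`):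
either the whole time is used by the cycles, or f(lam) = 0 and the idle time does not matter. For j
= 0 a single long flight is enough.

The shape of I: the tangent plane of `logGen` at (0, 0) gives f(lam) ≥ lam j*, which with f ≥ 0
makes I vanish between 0 and j*. The symmetry lam ↦ βL - βR - lam of f carries this to the segment
between -j* and 0. -/

/-- The kinetic energy `1 / (2 x²)` of a particle whose flight between the walls lasts `x`. -/
def kin (x : ℝ) : ℝ := 1 / (2 * x ^ 2)

/-- The weight `x⁻³ exp (-(a / (2 x²) + s x))` of a flight of duration `x`. -/
def boltz (a s x : ℝ) : ℝ := (x ^ 3)⁻¹ * Real.exp (-(a * kin x + s * x))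

/-- The integral of `w` against the weight `boltz a s` on the positive half-line. -/
def boltzInt (w : ℝ → ℝ) (a s : ℝ) : ℝ := ∫ x in Set.Ioi (0 : ℝ), w x * boltz a s x

/-- The total mass of the weight `boltz a s`. -/
def partFn (a s : ℝ) : ℝ := boltzInt (fun _ => 1) a s

/-- The mean kinetic energy under the normalized weight `boltz a s`. -/
def meanKin (a s : ℝ) : ℝ := boltzInt kin a s / partFn a s

/-- The mean flight time under the normalized weight `boltz a s`. -/
def meanTime (a s : ℝ) : ℝ := boltzInt id a s / partFn a s

/-- The weight function `w` is integrable against every `boltz a 0` with `a > 0`. -/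
structure Tame (w : ℝ → ℝ) : Prop where
  meas : Measurable w
  integrable : ∀ a, 0 < a → IntegrableOn (fun x => w x * boltz a 0 x) (Set.Ioi 0)

/-! ### The weight of one flight: Gamma integrals, continuity, convexity -/

theorem measurable_kin : Measurable kin := by unfold kin; fun_prop

theorem measurable_boltz (a s : ℝ) : Measurable (boltz a s) := by
  have := measurable_kin
  unfold boltz; fun_prop

theorem kin_pos {x : ℝ} (hx : 0 < x) : 0 < kin x := by unfold kin; positivity

theorem boltz_pos (a s : ℝ) {x : ℝ} (hx : 0 < x) : 0 < boltz a s x := by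
  unfold boltz; positivity

theorem boltz_anti {a a' s s' x : ℝ} (ha : a ≤ a') (hs : s ≤ s') (hx : 0 < x) :
    boltz a' s' x ≤ boltz a s x := by
  have := kin_pos hx
  unfold boltz; gcongr

/-- The change of variable y = x⁻² turns the weight into a Gamma density; the left side is the
transformed integrand in the form that the substitution theorems expect. -/
theorem rpow_mul_boltz {q a x : ℝ} (hx : 0 < x) :
    (|(-2 : ℝ)| * x ^ ((-2 : ℝ) - 1)) •
      (1 / 2 * ((x ^ (-2 : ℝ)) ^ ((1 - q / 2) - 1) * Real.exp (-(a / 2 * x ^ (-2 : ℝ))))) =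
    x ^ q * boltz a 0 x := by
  have h2 : x ^ (-2 : ℝ) = (x ^ 2)⁻¹ := by
    rw [Real.rpow_neg hx.le]; norm_num
  have h3 : x ^ ((-2 : ℝ) - 1) = (x ^ 3)⁻¹ := by
    rw [show (-2 : ℝ) - 1 = -3 by norm_num, Real.rpow_neg hx.le]; norm_num
  have hq : (x ^ (-2 : ℝ)) ^ ((1 - q / 2) - 1) = x ^ q := by
    rw [← Real.rpow_mul hx.le]; congr 1; ring
  rw [hq, h3, h2, boltz, kin, smul_eq_mul, abs_neg, abs_two]
  have : -(a / 2 * (x ^ 2)⁻¹) = -(a * (1 / (2 * x ^ 2)) + 0 * x) := by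
    field_simp; ring
  rw [this]; ring

theorem integrableOn_rpow_mul_boltz {q a : ℝ} (hq : q < 2) (ha : 0 < a) :
    IntegrableOn (fun x => x ^ q * boltz a 0 x) (Set.Ioi 0) := by
  have h := (integrableOn_Ioi_comp_rpow_iff
    (fun y : ℝ => 1 / 2 * (y ^ ((1 - q / 2) - 1) * Real.exp (-(a / 2 * y))))
    (p := -2) (by norm_num)).2 ?_
  · exact h.congr_fun (fun x hx => rpow_mul_boltz hx) measurableSet_Ioi
  · apply Integrable.const_mul
    -- The Bochner integral of a non-integrable function is 0, so the explicit nonzero value proves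
    -- integrability; q < 2 makes the Gamma argument 1 - q / 2 positive.
    refine Integrable.of_integral_ne_zero ?_
    rw [Real.integral_rpow_mul_exp_neg_mul_Ioi (by linarith) (by linarith)]
    have := Real.Gamma_pos_of_pos (show 0 < 1 - q / 2 by linarith)
    positivity

theorem integral_rpow_mul_boltz {q a : ℝ} (hq : q < 2) (ha : 0 < a) :
    ∫ x in Set.Ioi (0 : ℝ), x ^ q * boltz a 0 x =
      1 / 2 * ((2 / a) ^ (1 - q / 2) * Real.Gamma (1 - q / 2)) := by
  rw [← setIntegral_congr_fun measurableSet_Ioi (fun x hx => rpow_mul_boltz (q := q) (a := a) hx),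
    integral_comp_rpow_Ioi
    (fun y : ℝ => 1 / 2 * (y ^ ((1 - q / 2) - 1) * Real.exp (-(a / 2 * y)))) (by norm_num),
    integral_const_mul, Real.integral_rpow_mul_exp_neg_mul_Ioi (by linarith) (by linarith)]
  rw [one_div_div]

theorem tame_one : Tame fun _ => 1 where
  meas := measurable_const
  integrable a ha := by
    simpa using integrableOn_rpow_mul_boltz (q := 0) (by norm_num) ha

theorem tame_id : Tame id where
  meas := measurable_id
  integrable a ha := by
    simpa using integrableOn_rpow_mul_boltz (q := 1) (by norm_num) ha

theorem tame_kin : Tame kin where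
  meas := measurable_kin
  integrable a ha := by
    have h := (integrableOn_rpow_mul_boltz (q := -2) (by norm_num) ha).const_mul (1 / 2)
    refine IntegrableOn.congr_fun h (fun x (hx : 0 < x) => ?_) measurableSet_Ioi
    have h2 : x ^ (-2 : ℝ) = (x ^ 2)⁻¹ := by
      rw [Real.rpow_neg hx.le]; norm_num
    simp only [h2, kin]
    field_simp

theorem Tame.integrableOn {w : ℝ → ℝ} (hw : Tame w) {a s : ℝ} (ha : 0 < a) (hs : 0 ≤ s) :
    IntegrableOn (fun x => w x * boltz a s x) (Set.Ioi 0) := by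
  refine Integrable.mono (hw.integrable a ha) ((hw.meas.mul (measurable_boltz a s)).aestronglyMeasurable) ?_
  refine (ae_restrict_iff' measurableSet_Ioi).2 (ae_of_all _ fun x hx => ?_)
  rw [norm_mul, norm_mul, Real.norm_of_nonneg (boltz_pos a s hx).le,
    Real.norm_of_nonneg (boltz_pos a 0 hx).le]
  gcongr
  exact boltz_anti le_rfl hs hx

/-- Dominated convergence, with the weight at (a / 2, 0) as the bound near (a, s). The boundary s =
0 is included, since the flat piece of the limit lives there. -/
theorem Tame.continuousOn {w : ℝ → ℝ} (hw : Tame w) :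
    ContinuousOn (fun p : ℝ × ℝ => boltzInt w p.1 p.2) (Set.Ioi 0 ×ˢ Set.Ici 0) := by
  rintro ⟨a, s⟩ ⟨ha, hs⟩
  simp only [Set.mem_Ioi, Set.mem_Ici] at ha hs
  have hmem : ∀ᶠ p : ℝ × ℝ in 𝓝[Set.Ioi 0 ×ˢ Set.Ici 0] (a, s), a / 2 < p.1 ∧ 0 ≤ p.2 := by
    have h1 : ∀ᶠ p : ℝ × ℝ in 𝓝 (a, s), a / 2 < p.1 :=
      continuousAt_fst.eventually (lt_mem_nhds (show a / 2 < (a, s).1 by simp; linarith))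
    filter_upwards [nhdsWithin_le_nhds h1, self_mem_nhdsWithin] with p hp hp'
    exact ⟨hp, hp'.2⟩
  refine continuousWithinAt_of_dominated (bound := fun x => ‖w x * boltz (a / 2) 0 x‖) ?_ ?_
    (hw.integrable (a / 2) (by linarith)).norm ?_
  · exact Eventually.of_forall fun p => (hw.meas.mul (measurable_boltz _ _)).aestronglyMeasurable
  · filter_upwards [hmem] with p hp
    refine (ae_restrict_iff' measurableSet_Ioi).2 (ae_of_all _ fun x hx => ?_)
    rw [norm_mul, norm_mul, Real.norm_of_nonneg (boltz_pos _ _ hx).le,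
      Real.norm_of_nonneg (boltz_pos _ _ hx).le]
    gcongr
    exact boltz_anti hp.1.le hp.2 hx
  · refine ae_of_all _ fun x => ContinuousAt.continuousWithinAt ?_
    unfold boltz
    fun_prop

theorem setIntegral_Ioi_pos {g : ℝ → ℝ} (hg : IntegrableOn g (Set.Ioi 0))
    (hpos : ∀ x, 0 < x → 0 < g x) : 0 < ∫ x in Set.Ioi (0 : ℝ), g x := by
  rw [setIntegral_pos_iff_support_of_nonneg_ae _ hg]
  · have : Set.Ioi (0 : ℝ) ⊆ Function.support g ∩ Set.Ioi 0 :=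
      fun x hx => ⟨(hpos x hx).ne', hx⟩
    exact lt_of_lt_of_le (by simp) (measure_mono this)
  · exact (ae_restrict_iff' measurableSet_Ioi).2 (ae_of_all _ fun x hx => (hpos x hx).le)

theorem partFn_pos {a s : ℝ} (ha : 0 < a) (hs : 0 ≤ s) : 0 < partFn a s :=
  setIntegral_Ioi_pos (tame_one.integrableOn ha hs) fun _ hx => by
    simpa using boltz_pos a s hx

theorem meanTime_pos {a s : ℝ} (ha : 0 < a) (hs : 0 ≤ s) : 0 < meanTime a s :=
  div_pos (setIntegral_Ioi_pos (tame_id.integrableOn ha hs) fun _ hx =>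
    mul_pos hx (boltz_pos a s hx)) (partFn_pos ha hs)

theorem continuousOn_partFn :
    ContinuousOn (fun p : ℝ × ℝ => partFn p.1 p.2) (Set.Ioi 0 ×ˢ Set.Ici 0) :=
  tame_one.continuousOn

theorem continuousOn_meanKin :
    ContinuousOn (fun p : ℝ × ℝ => meanKin p.1 p.2) (Set.Ioi 0 ×ˢ Set.Ici 0) :=
  tame_kin.continuousOn.div continuousOn_partFn fun _ hp => (partFn_pos hp.1 hp.2).ne'

theorem continuousOn_meanTime :
    ContinuousOn (fun p : ℝ × ℝ => meanTime p.1 p.2) (Set.Ioi 0 ×ˢ Set.Ici 0) :=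
  tame_id.continuousOn.div continuousOn_partFn fun _ hp => (partFn_pos hp.1 hp.2).ne'

/-- The gradient inequality for the convex function `log ∘ partFn`. -/
theorem log_partFn_ge {a s a' s' : ℝ} (ha : 0 < a) (hs : 0 ≤ s) (ha' : 0 < a') (hs' : 0 ≤ s') :
    Real.log (partFn a s) - (a' - a) * meanKin a s - (s' - s) * meanTime a s ≤
      Real.log (partFn a' s') := by
  have hZ := partFn_pos ha hs
  -- Jensen's inequality: y₀ is the mean, under the normalized weight at (a, s), of the exponent y
  -- that leads to (a', s'). The tangent line of exp at y₀ bounds exp y from below and is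
  -- integrated.
  set y₀ := -((a' - a) * meanKin a s) - (s' - s) * meanTime a s with hy₀
  have hlin : IntegrableOn (fun x => Real.exp y₀ * ((1 - y₀) * (1 * boltz a s x) -
      (a' - a) * (kin x * boltz a s x) - (s' - s) * (id x * boltz a s x))) (Set.Ioi 0) :=
    Integrable.const_mul ((((tame_one.integrableOn ha hs).const_mul _).sub
      ((tame_kin.integrableOn ha hs).const_mul _)).sub
      ((tame_id.integrableOn ha hs).const_mul _)) _
  have hle : ∫ x in Set.Ioi (0 : ℝ), Real.exp y₀ * ((1 - y₀) * (1 * boltz a s x) -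
      (a' - a) * (kin x * boltz a s x) - (s' - s) * (id x * boltz a s x)) ≤ partFn a' s' := by
    refine setIntegral_mono_on hlin (tame_one.integrableOn ha' hs') measurableSet_Ioi
      fun x (hx : 0 < x) => ?_
    have hb : boltz a' s' x =
        boltz a s x * Real.exp (-((a' - a) * kin x) - (s' - s) * x) := by
      unfold boltz
      rw [mul_assoc, ← Real.exp_add]; congr 2; ring
    set y := -((a' - a) * kin x) - (s' - s) * x with hy
    have h1 : y - y₀ + 1 ≤ Real.exp (y - y₀) := Real.add_one_le_exp _
    have h2 : Real.exp y = Real.exp y₀ * Real.exp (y - y₀) := by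
      rw [← Real.exp_add]; congr 1; ring
    have hpos : 0 < boltz a s x * Real.exp y₀ := mul_pos (boltz_pos a s hx) (Real.exp_pos _)
    calc _ = boltz a s x * Real.exp y₀ * (y - y₀ + 1) := by rw [hy]; simp only [id]; ring
      _ ≤ boltz a s x * Real.exp y₀ * Real.exp (y - y₀) := by gcongr
      _ = 1 * boltz a' s' x := by rw [hb, h2]; ring
  have heq : ∫ x in Set.Ioi (0 : ℝ), Real.exp y₀ * ((1 - y₀) * (1 * boltz a s x) -
      (a' - a) * (kin x * boltz a s x) - (s' - s) * (id x * boltz a s x)) =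
      Real.exp y₀ * partFn a s := by
    rw [integral_const_mul, integral_sub, integral_sub, integral_const_mul (1 - y₀),
      integral_const_mul (a' - a), integral_const_mul (s' - s)]
    · have e1 : ∫ x in Set.Ioi (0 : ℝ), kin x * boltz a s x = meanKin a s * partFn a s :=
        (div_mul_cancel₀ _ hZ.ne').symm
      have e2 : ∫ x in Set.Ioi (0 : ℝ), id x * boltz a s x = meanTime a s * partFn a s :=
        (div_mul_cancel₀ _ hZ.ne').symm
      have e3 : ∫ x in Set.Ioi (0 : ℝ), 1 * boltz a s x = partFn a s := rfl
      rw [e1, e2, e3, hy₀]; ring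
    · exact (tame_one.integrableOn ha hs).const_mul _
    · exact (tame_kin.integrableOn ha hs).const_mul _
    · exact ((tame_one.integrableOn ha hs).const_mul _).sub
        ((tame_kin.integrableOn ha hs).const_mul _)
    · exact (tame_id.integrableOn ha hs).const_mul _
  rw [heq] at hle
  have := Real.log_le_log (by positivity) hle
  rw [Real.log_mul (Real.exp_pos _).ne' hZ.ne', Real.log_exp] at this
  linarith

theorem partFn_zero {a : ℝ} (ha : 0 < a) : partFn a 0 = 1 / a := by
  have := integral_rpow_mul_boltz (q := 0) (by norm_num) ha
  simp only [Real.rpow_zero, zero_div, sub_zero, Real.rpow_one, Real.Gamma_one] at this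
  rw [partFn, boltzInt, this]; field_simp

theorem meanKin_zero {a : ℝ} (ha : 0 < a) : meanKin a 0 = 1 / a := by
  have := integral_rpow_mul_boltz (q := -2) (by norm_num) ha
  rw [meanKin, partFn_zero ha, boltzInt]
  have h : ∫ x in Set.Ioi (0 : ℝ), kin x * boltz a 0 x =
      1 / 2 * ∫ x in Set.Ioi (0 : ℝ), x ^ (-2 : ℝ) * boltz a 0 x := by
    rw [← integral_const_mul]
    refine setIntegral_congr_fun measurableSet_Ioi fun x (hx : 0 < x) => ?_
    have h2 : x ^ (-2 : ℝ) = (x ^ 2)⁻¹ := by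
      rw [Real.rpow_neg hx.le]; norm_num
    simp only [h2, kin]; field_simp
  rw [h, this]
  norm_num [Real.Gamma_two]
  field_simp

theorem meanTime_zero {a : ℝ} (ha : 0 < a) : meanTime a 0 = √(Real.pi * a / 2) := by
  have := integral_rpow_mul_boltz (q := 1) (by norm_num) ha
  simp only [Real.rpow_one] at this
  rw [meanTime, partFn_zero ha, boltzInt]
  simp only [id]
  rw [this, show (1 : ℝ) - 1 / 2 = 1 / 2 by norm_num, Real.Gamma_one_half_eq, ← Real.sqrt_eq_rpow,
    ← Real.sqrt_mul (by positivity)]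
  rw [eq_comm, Real.sqrt_eq_iff_mul_self_eq_of_pos (by positivity)]
  have h : √(2 / a * Real.pi) * √(2 / a * Real.pi) = 2 / a * Real.pi :=
    Real.mul_self_sqrt (by positivity)
  field_simp at h ⊢
  nlinarith [h]

theorem tendsto_partFn_atTop {a : ℝ} (ha : 0 < a) :
    Tendsto (fun s => partFn a s) atTop (𝓝 0) := by
  have := tendsto_integral_filter_of_dominated_convergence (μ := volume.restrict (Set.Ioi (0:ℝ)))
    (l := atTop) (F := fun s x => 1 * boltz a s x) (f := fun _ => (0 : ℝ))
    (fun x => 1 * boltz a 0 x) ?_ ?_ (tame_one.integrable a ha) ?_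
  · simpa [partFn, boltzInt] using this
  · exact Eventually.of_forall fun s =>
      (measurable_const.mul (measurable_boltz a s)).aestronglyMeasurable
  · filter_upwards [eventually_ge_atTop 0] with s hs
    refine (ae_restrict_iff' measurableSet_Ioi).2 (ae_of_all _ fun x hx => ?_)
    rw [one_mul, one_mul, Real.norm_of_nonneg (boltz_pos a s hx).le]
    exact boltz_anti le_rfl hs hx
  · refine (ae_restrict_iff' measurableSet_Ioi).2 (ae_of_all _ fun x (hx : 0 < x) => ?_)
    have h1 : Tendsto (fun s : ℝ => -(a * kin x + s * x)) atTop atBot :=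
      tendsto_neg_atTop_atBot.comp (tendsto_atTop_add_const_left _ _
        (tendsto_id.atTop_mul_const hx))
    simpa [boltz] using (Real.tendsto_exp_atBot.comp h1).const_mul (x ^ 3)⁻¹


/-! ### Cycles of two flights and the function `cgf` -/

/-- The logarithm of `E[exp (lam X - s T)]`, where `X` is the energy exchanged and `T` the time
elapsed during a cycle of two flights. -/
def logGen (βL βR lam s : ℝ) : ℝ :=
  Real.log (βL * βR) + Real.log (partFn (βL - lam) s) + Real.log (partFn (βR + lam) s)

/-- The mean energy exchanged in a cycle tilted by `exp (lam X - s T)`. -/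
def cycleCurrent (βL βR lam s : ℝ) : ℝ := meanKin (βL - lam) s - meanKin (βR + lam) s

/-- The mean duration of a cycle tilted by `exp (lam X - s T)`. -/
def cycleTime (βL βR lam s : ℝ) : ℝ := meanTime (βL - lam) s + meanTime (βR + lam) s

/-- The cumulant generating function of the current where it is finite. -/
def cgf (βL βR lam : ℝ) : ℝ := sInf {s | 0 ≤ s ∧ logGen βL βR lam s ≤ 0}

section

variable {βL βR : ℝ}

/-- The fluctuation symmetry: the reflection exchanges βL - lam and βR + lam, that is, the roles of
the two flights of a cycle. -/
theorem logGen_symm (lam s : ℝ) : logGen βL βR (βL - βR - lam) s = logGen βL βR lam s := by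
  unfold logGen
  rw [show βL - (βL - βR - lam) = βR + lam by ring, show βR + (βL - βR - lam) = βL - lam by ring]
  ring

theorem cycleCurrent_symm (lam s : ℝ) :
    cycleCurrent βL βR (βL - βR - lam) s = -cycleCurrent βL βR lam s := by
  unfold cycleCurrent
  rw [show βL - (βL - βR - lam) = βR + lam by ring, show βR + (βL - βR - lam) = βL - lam by ring]
  ring

theorem cycleTime_symm (lam s : ℝ) :
    cycleTime βL βR (βL - βR - lam) s = cycleTime βL βR lam s := by
  unfold cycleTime
  rw [show βL - (βL - βR - lam) = βR + lam by ring, show βR + (βL - βR - lam) = βL - lam by ring]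
  ring

theorem cgf_symm (lam : ℝ) : cgf βL βR (βL - βR - lam) = cgf βL βR lam := by
  simp only [cgf, logGen_symm]

/-- Convexity of `logGen` in the form used throughout: it lies above its tangent planes, whose
gradient is (`cycleCurrent`, -`cycleTime`). No derivative has to be computed. -/
theorem logGen_ge {lam s lam' s' : ℝ} (hlam : lam ∈ Set.Ioo (-βR) βL) (hs : 0 ≤ s)
    (hlam' : lam' ∈ Set.Ioo (-βR) βL) (hs' : 0 ≤ s') :
    logGen βL βR lam s + (lam' - lam) * cycleCurrent βL βR lam s -
      (s' - s) * cycleTime βL βR lam s ≤ logGen βL βR lam' s' := by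
  have h1 := log_partFn_ge (sub_pos.2 hlam.2) hs (sub_pos.2 hlam'.2) hs'
  have h2 := log_partFn_ge (a := βR + lam) (a' := βR + lam') (by linarith [hlam.1]) hs
    (by linarith [hlam'.1]) hs'
  unfold logGen cycleCurrent cycleTime
  linarith

theorem cycleTime_pos {lam s : ℝ} (hlam : lam ∈ Set.Ioo (-βR) βL) (hs : 0 ≤ s) :
    0 < cycleTime βL βR lam s :=
  add_pos (meanTime_pos (sub_pos.2 hlam.2) hs) (meanTime_pos (by linarith [hlam.1]) hs)

theorem logGen_lt {lam s s' : ℝ} (hlam : lam ∈ Set.Ioo (-βR) βL) (hs : 0 ≤ s) (h : s < s') :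
    logGen βL βR lam s' < logGen βL βR lam s := by
  have h1 := logGen_ge hlam (hs.trans h.le) hlam hs
  have h2 := mul_pos (sub_pos.2 h) (cycleTime_pos hlam (hs.trans h.le))
  linarith

theorem continuousOn_comp_sub {F : ℝ → ℝ → ℝ}
    (hF : ContinuousOn (fun p : ℝ × ℝ => F p.1 p.2) (Set.Ioi 0 ×ˢ Set.Ici 0)) :
    ContinuousOn (fun p : ℝ × ℝ => F (βL - p.1) p.2) (Set.Ioo (-βR) βL ×ˢ Set.Ici 0) :=
  ContinuousOn.comp (g := fun p : ℝ × ℝ => F p.1 p.2) (f := fun p : ℝ × ℝ => (βL - p.1, p.2)) hF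
    (by fun_prop) fun _ hp => ⟨sub_pos.2 hp.1.2, hp.2⟩

theorem continuousOn_comp_add {F : ℝ → ℝ → ℝ}
    (hF : ContinuousOn (fun p : ℝ × ℝ => F p.1 p.2) (Set.Ioi 0 ×ˢ Set.Ici 0)) :
    ContinuousOn (fun p : ℝ × ℝ => F (βR + p.1) p.2) (Set.Ioo (-βR) βL ×ˢ Set.Ici 0) :=
  ContinuousOn.comp (g := fun p : ℝ × ℝ => F p.1 p.2) (f := fun p : ℝ × ℝ => (βR + p.1, p.2)) hF
    (by fun_prop) fun _ hp => ⟨neg_lt_iff_pos_add'.1 hp.1.1, hp.2⟩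

theorem continuousOn_logGen :
    ContinuousOn (fun p : ℝ × ℝ => logGen βL βR p.1 p.2) (Set.Ioo (-βR) βL ×ˢ Set.Ici 0) := by
  have h : ContinuousOn (fun p : ℝ × ℝ => Real.log (partFn p.1 p.2)) (Set.Ioi 0 ×ˢ Set.Ici 0) :=
    continuousOn_partFn.log fun p hp => (partFn_pos hp.1 hp.2).ne'
  exact (continuousOn_const.add (continuousOn_comp_sub (F := fun a s => Real.log (partFn a s)) h)).add
    (continuousOn_comp_add (F := fun a s => Real.log (partFn a s)) h)

theorem continuousOn_cycleCurrent :
    ContinuousOn (fun p : ℝ × ℝ => cycleCurrent βL βR p.1 p.2)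
      (Set.Ioo (-βR) βL ×ˢ Set.Ici 0) :=
  (continuousOn_comp_sub continuousOn_meanKin).sub (continuousOn_comp_add continuousOn_meanKin)

theorem continuousOn_cycleTime :
    ContinuousOn (fun p : ℝ × ℝ => cycleTime βL βR p.1 p.2)
      (Set.Ioo (-βR) βL ×ˢ Set.Ici 0) :=
  (continuousOn_comp_sub continuousOn_meanTime).add (continuousOn_comp_add continuousOn_meanTime)

theorem continuousAt_logGen_left {lam s : ℝ} (hlam : lam ∈ Set.Ioo (-βR) βL) (hs : 0 ≤ s) :
    ContinuousAt (fun l => logGen βL βR l s) lam := by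
  have : ContinuousOn (fun l => logGen βL βR l s) (Set.Ioo (-βR) βL) :=
    continuousOn_logGen.comp (f := fun l => (l, s)) (by fun_prop) fun l hl => ⟨hl, hs⟩
  exact this.continuousAt (isOpen_Ioo.mem_nhds hlam)

theorem continuousWithinAt_logGen_right {lam s : ℝ} (hlam : lam ∈ Set.Ioo (-βR) βL)
    (hs : 0 ≤ s) : ContinuousWithinAt (fun x => logGen βL βR lam x) (Set.Ici 0) s :=
  (continuousOn_logGen.comp (f := fun x => (lam, x)) (by fun_prop)
    (fun x hx => ⟨hlam, hx⟩)) s hs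

theorem exists_logGen_neg (hL : 0 < βL) (hR : 0 < βR) {lam : ℝ}
    (hlam : lam ∈ Set.Ioo (-βR) βL) : ∃ s, 0 ≤ s ∧ logGen βL βR lam s < 0 := by
  have ha : 0 < βL - lam := sub_pos.2 hlam.2
  have hb : 0 < βR + lam := by linarith [hlam.1]
  have h := ((tendsto_partFn_atTop ha).mul (tendsto_partFn_atTop hb)).const_mul (βL * βR)
  rw [mul_zero, mul_zero] at h
  obtain ⟨s, hs, h1⟩ := ((eventually_ge_atTop 0).and (h.eventually (gt_mem_nhds one_pos))).exists
  refine ⟨s, hs, ?_⟩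
  have p1 := partFn_pos ha hs
  have p2 := partFn_pos hb hs
  rw [logGen, ← Real.log_mul (by positivity) p1.ne', ← Real.log_mul (by positivity) p2.ne']
  refine Real.log_neg (by positivity) ?_
  rwa [mul_assoc]

theorem cgf_nonneg (βL βR lam : ℝ) : 0 ≤ cgf βL βR lam := Real.sInf_nonneg fun _ hs => hs.1

theorem cgf_le {lam s : ℝ} (hs : 0 ≤ s) (h : logGen βL βR lam s ≤ 0) : cgf βL βR lam ≤ s :=
  csInf_le ⟨0, fun _ hs => hs.1⟩ ⟨hs, h⟩

theorem logGen_neg_of_cgf_lt (hL : 0 < βL) (hR : 0 < βR) {lam s : ℝ}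
    (hlam : lam ∈ Set.Ioo (-βR) βL) (h : cgf βL βR lam < s) : logGen βL βR lam s < 0 := by
  obtain ⟨s₀, hs₀, hneg⟩ := exists_logGen_neg hL hR hlam
  obtain ⟨s₁, hs₁, hlt⟩ := exists_lt_of_csInf_lt
    (⟨s₀, hs₀, hneg.le⟩ : {s | 0 ≤ s ∧ logGen βL βR lam s ≤ 0}.Nonempty) h
  exact (logGen_lt hlam hs₁.1 hlt).trans_le hs₁.2

theorem logGen_pos_of_lt_cgf {lam s : ℝ} (hs : 0 ≤ s) (h : s < cgf βL βR lam) :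
    0 < logGen βL βR lam s := by
  by_contra! hle
  exact absurd (cgf_le hs hle) (not_le.2 h)

/-- Since `logGen` is strictly decreasing in s, its sign at s tells on which side of s the value
`cgf` lies, and a strict sign persists for nearby lam. -/
theorem continuousAt_cgf (hL : 0 < βL) (hR : 0 < βR) {lam : ℝ} (hlam : lam ∈ Set.Ioo (-βR) βL) :
    ContinuousAt (cgf βL βR) lam := by
  refine tendsto_order.2 ⟨fun s hs => ?_, fun s hs => ?_⟩
  · rcases lt_or_ge s 0 with h0 | h0
    · exact Eventually.of_forall fun l => h0.trans_le (cgf_nonneg βL βR l)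
    · filter_upwards [(continuousAt_logGen_left hlam h0).eventually
        (lt_mem_nhds (logGen_pos_of_lt_cgf h0 hs)), isOpen_Ioo.mem_nhds hlam] with l hl hl'
      by_contra! hle
      rcases hle.lt_or_eq with h | h
      · exact absurd (logGen_neg_of_cgf_lt hL hR hl' h) (not_lt.2 hl.le)
      -- If `cgf` equals s exactly, nothing is known about strict negativity at s itself; continuity
      -- from the right moves to some s' > s where `logGen` is still positive.
      · obtain ⟨s', hs', hl''⟩ : ∃ s', s < s' ∧ 0 < logGen βL βR l s' := by
          have h3 : ∀ᶠ x in 𝓝[>] s, 0 < logGen βL βR l x :=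
            ((continuousWithinAt_logGen_right hl' h0).mono (fun x (hx : s < x) => h0.trans hx.le)).eventually (lt_mem_nhds hl)
          obtain ⟨x, hx, hx'⟩ := (h3.and self_mem_nhdsWithin).exists
          exact ⟨x, hx', hx⟩
        exact absurd (logGen_neg_of_cgf_lt hL hR hl' (h.trans_lt hs')) (not_lt.2 hl''.le)
  · have h0 := cgf_nonneg βL βR lam
    obtain ⟨s', h1, h2⟩ := exists_between hs
    filter_upwards [(continuousAt_logGen_left hlam (h0.trans h1.le)).eventually
      (gt_mem_nhds (logGen_neg_of_cgf_lt hL hR hlam h1))] with l hl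
    exact (cgf_le (h0.trans h1.le) hl.le).trans_lt h2

theorem logGen_cgf_le (hL : 0 < βL) (hR : 0 < βR) {lam : ℝ} (hlam : lam ∈ Set.Ioo (-βR) βL) :
    logGen βL βR lam (cgf βL βR lam) ≤ 0 := by
  have h0 : 0 ≤ cgf βL βR lam := cgf_nonneg βL βR lam
  have hc : Tendsto (fun x => logGen βL βR lam x) (𝓝[>] (cgf βL βR lam)) (𝓝 _) :=
    (continuousWithinAt_logGen_right hlam h0).mono
      (fun x (hx : cgf βL βR lam < x) => h0.trans hx.le)
  refine le_of_tendsto hc ?_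
  filter_upwards [self_mem_nhdsWithin] with x hx
  exact (logGen_neg_of_cgf_lt hL hR hlam hx).le

theorem logGen_cgf (hL : 0 < βL) (hR : 0 < βR) {lam : ℝ} (hlam : lam ∈ Set.Ioo (-βR) βL)
    (h0 : 0 ≤ logGen βL βR lam 0) : logGen βL βR lam (cgf βL βR lam) = 0 := by
  refine le_antisymm (logGen_cgf_le hL hR hlam) ?_
  rcases (cgf_nonneg βL βR lam).eq_or_lt with h | h
  · rwa [← h]
  · have hc : Tendsto (fun x => logGen βL βR lam x) (𝓝[Set.Ico 0 (cgf βL βR lam)] (cgf βL βR lam))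
        (𝓝 _) := (continuousWithinAt_logGen_right hlam h.le).mono fun x hx => hx.1
    have : (𝓝[Set.Ico 0 (cgf βL βR lam)] (cgf βL βR lam)).NeBot := by
      rw [← mem_closure_iff_nhdsWithin_neBot, closure_Ico h.ne]
      exact ⟨h.le, le_rfl⟩
    refine ge_of_tendsto hc ?_
    filter_upwards [self_mem_nhdsWithin] with x hx
    exact (logGen_pos_of_lt_cgf hx.1 hx.2).le

/-- Since (βL - lam)(βR + lam) = βL βR - lam (lam - (βL - βR)), the sign at s = 0 is that of lam
(lam - (βL - βR)). This locates the zeros of `cgf` between 0 and βL - βR. -/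
theorem logGen_zero (hL : 0 < βL) (hR : 0 < βR) {lam : ℝ} (hlam : lam ∈ Set.Ioo (-βR) βL) :
    logGen βL βR lam 0 = Real.log (βL * βR / ((βL - lam) * (βR + lam))) := by
  have ha : 0 < βL - lam := sub_pos.2 hlam.2
  have hb : 0 < βR + lam := by linarith [hlam.1]
  rw [logGen, partFn_zero ha, partFn_zero hb,
    Real.log_div (x := βL * βR) (by positivity) (by positivity), Real.log_mul ha.ne' hb.ne', one_div, one_div, Real.log_inv, Real.log_inv]
  ring

theorem logGen_zero_nonneg (hL : 0 < βL) (hR : 0 < βR) {lam : ℝ} (hlam : lam ∈ Set.Ioo (-βR) βL)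
    (h : 0 ≤ lam * (lam - (βL - βR))) : 0 ≤ logGen βL βR lam 0 := by
  have ha : 0 < βL - lam := sub_pos.2 hlam.2
  have hb : 0 < βR + lam := by linarith [hlam.1]
  rw [logGen_zero hL hR hlam]
  refine Real.log_nonneg ((one_le_div (by positivity)).2 ?_)
  nlinarith

theorem logGen_zero_pos (hL : 0 < βL) (hR : 0 < βR) {lam : ℝ} (hlam : lam ∈ Set.Ioo (-βR) βL)
    (h : 0 < lam * (lam - (βL - βR))) : 0 < logGen βL βR lam 0 := by
  have ha : 0 < βL - lam := sub_pos.2 hlam.2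
  have hb : 0 < βR + lam := by linarith [hlam.1]
  rw [logGen_zero hL hR hlam]
  refine Real.log_pos ((one_lt_div (by positivity)).2 ?_)
  nlinarith

theorem logGen_zero_nonpos (hL : 0 < βL) (hR : 0 < βR) {lam : ℝ} (hlam : lam ∈ Set.Ioo (-βR) βL)
    (h : lam * (lam - (βL - βR)) ≤ 0) : logGen βL βR lam 0 ≤ 0 := by
  have ha : 0 < βL - lam := sub_pos.2 hlam.2
  have hb : 0 < βR + lam := by linarith [hlam.1]
  rw [logGen_zero hL hR hlam]
  refine Real.log_nonpos (by positivity) ((div_le_one (by positivity)).2 ?_)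
  nlinarith

theorem cgf_eq_zero (hL : 0 < βL) (hR : 0 < βR) {lam : ℝ} (hlam : lam ∈ Set.Ioo (-βR) βL)
    (h : lam * (lam - (βL - βR)) ≤ 0) : cgf βL βR lam = 0 :=
  le_antisymm (cgf_le le_rfl (logGen_zero_nonpos hL hR hlam h)) (cgf_nonneg βL βR lam)

theorem cgf_pos (hL : 0 < βL) (hR : 0 < βR) {lam : ℝ} (hlam : lam ∈ Set.Ioo (-βR) βL)
    (h : 0 < lam * (lam - (βL - βR))) : 0 < cgf βL βR lam := by
  refine (cgf_nonneg βL βR lam).lt_of_ne fun h0 => ?_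
  have := logGen_cgf_le hL hR hlam
  rw [← h0] at this
  exact absurd (logGen_zero_pos hL hR hlam h) (not_lt.2 this)

/-- Blow-up at the end of the domain: the tangent plane at s = 0 bounds log `partFn` at (a, K) below
by -log a - K √(π a / 2), and -log (βL - lam) tends to infinity. This lets the tilts reach
arbitrarily large currents. -/
theorem eventually_lt_cgf (hL : 0 < βL) (hR : 0 < βR) {K : ℝ} (hK : 0 ≤ K) :
    ∀ᶠ lam in 𝓝[<] βL, K ≤ cgf βL βR lam := by
  set C := Real.log (βL * βR) - Real.log (βR + βL) - 2 * (K * √(Real.pi * (βR + βL) / 2)) with hC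
  have hlim : Tendsto (fun lam => Real.log (βL - lam)) (𝓝[<] βL) atBot := by
    refine Real.tendsto_log_nhdsGT_zero.comp (tendsto_nhdsWithin_iff.2 ⟨?_, ?_⟩)
    · have : Tendsto (fun lam : ℝ => βL - lam) (𝓝 βL) (𝓝 (βL - βL)) := by
        exact (continuous_const.sub continuous_id).tendsto βL
      rw [sub_self] at this
      exact this.mono_left nhdsWithin_le_nhds
    · filter_upwards [self_mem_nhdsWithin] with l hl
      exact sub_pos.2 (Set.mem_Iio.1 hl)
  filter_upwards [hlim.eventually (eventually_lt_atBot C), self_mem_nhdsWithin,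
    nhdsWithin_le_nhds (lt_mem_nhds hL)] with lam h1 h2 h3
  have ha : 0 < βL - lam := sub_pos.2 h2
  have hb : 0 < βR + lam := by linarith
  have hlam : lam ∈ Set.Ioo (-βR) βL := ⟨by linarith, h2⟩
  have g1 := log_partFn_ge ha le_rfl ha hK
  have g2 := log_partFn_ge hb le_rfl hb hK
  rw [partFn_zero ha, meanTime_zero ha, one_div, Real.log_inv] at g1
  rw [partFn_zero hb, meanTime_zero hb, one_div, Real.log_inv] at g2
  have e1 : √(Real.pi * (βL - lam) / 2) ≤ √(Real.pi * (βR + βL) / 2) := by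
    apply Real.sqrt_le_sqrt; gcongr; linarith
  have e2 : √(Real.pi * (βR + lam) / 2) ≤ √(Real.pi * (βR + βL) / 2) := by
    apply Real.sqrt_le_sqrt; gcongr; exact h2.le
  have e3 := Real.log_le_log hb (show βR + lam ≤ βR + βL by linarith [h2.out])
  have e4 := mul_le_mul_of_nonneg_left e1 hK
  have e5 := mul_le_mul_of_nonneg_left e2 hK
  have hpos : 0 < logGen βL βR lam K := by
    unfold logGen
    linarith
  by_contra! hlt
  exact absurd (logGen_neg_of_cgf_lt hL hR hlam hlt) (not_lt.2 hpos.le)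

theorem continuousAt_comp_cgf (hL : 0 < βL) (hR : 0 < βR) {F : ℝ → ℝ → ℝ}
    (hF : ContinuousOn (fun p : ℝ × ℝ => F p.1 p.2) (Set.Ioo (-βR) βL ×ˢ Set.Ici 0)) {lam : ℝ}
    (hlam : lam ∈ Set.Ioo (-βR) βL) : ContinuousAt (fun l => F l (cgf βL βR l)) lam := by
  have : ContinuousOn (fun l => F l (cgf βL βR l)) (Set.Ioo (-βR) βL) :=
    hF.comp (f := fun l => (l, cgf βL βR l))
      (continuousOn_id.prodMk fun l hl => (continuousAt_cgf hL hR hl).continuousWithinAt)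
      fun l hl => ⟨hl, cgf_nonneg βL βR l⟩
  exact this.continuousAt (isOpen_Ioo.mem_nhds hlam)

/-! ### Optimal tilts for a prescribed current -/

/-- The current `j` is approached by running cycles tilted by `exp (lam X - s T)`, at a rate of `c`
cycles per unit time, with an exponential cost of at most `r + δ`. -/
def Approachable (βL βR j r δ : ℝ) : Prop :=
  ∃ lam ∈ Set.Ioo (-βR) βL, ∃ s c, 0 < s ∧ logGen βL βR lam s = 0 ∧ 0 < c ∧
    c * cycleTime βL βR lam s < 1 ∧ |c * cycleCurrent βL βR lam s - j| < δ ∧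
    c * (lam * cycleCurrent βL βR lam s - s * cycleTime βL βR lam s) < r + δ

/-- A constrained optimum: c cycles per unit time must produce j within time 1, and the last
equation is complementary slackness (all the time is used, or `cgf` = 0). It makes the cost c (lam m
- s θ) equal to lam j - `cgf` lam. -/
theorem exists_optimal_tilt (hL : 0 < βL) (hR : 0 < βR) {j : ℝ} (hj : 0 < j) :
    ∃ lam ∈ Set.Ico (max 0 (βL - βR)) βL, ∃ c, 0 < c ∧
      c * cycleCurrent βL βR lam (cgf βL βR lam) = j ∧
      c * cycleTime βL βR lam (cgf βL βR lam) ≤ 1 ∧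
      cgf βL βR lam * (c * cycleTime βL βR lam (cgf βL βR lam)) = cgf βL βR lam := by
  set l₀ := max 0 (βL - βR) with hl₀
  have h0 : 0 ≤ l₀ := le_max_left _ _
  have h0' : βL - βR ≤ l₀ := le_max_right _ _
  have h0L : l₀ < βL := max_lt hL (by linarith)
  have hdom : ∀ l ∈ Set.Ico l₀ βL, l ∈ Set.Ioo (-βR) βL :=
    fun l hl => ⟨by linarith [hl.1], hl.2⟩
  have hm₀ : l₀ ∈ Set.Ico l₀ βL := ⟨le_rfl, h0L⟩
  have hprod : l₀ * (l₀ - (βL - βR)) = 0 := by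
    rcases max_choice 0 (βL - βR) with h | h <;> rw [hl₀, h] <;> simp
  have hcgf₀ : cgf βL βR l₀ = 0 := cgf_eq_zero hL hR (hdom _ hm₀) hprod.le
  set m := fun l => cycleCurrent βL βR l (cgf βL βR l) with hm
  set θ := fun l => cycleTime βL βR l (cgf βL βR l) with hθ
  have hθpos : ∀ l ∈ Set.Ico l₀ βL, 0 < θ l :=
    fun l hl => cycleTime_pos (hdom l hl) (cgf_nonneg βL βR l)
  -- m / θ is the current of cycles run without pause. If at l₀, the right end of the zero segment
  -- of `cgf`, it is already at least j, the cycles are slowed down; otherwise lam is increased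
  -- until m / θ = j.
  rcases le_or_gt (j * θ l₀) (m l₀) with hcase | hcase
  · have hmpos : 0 < m l₀ := (mul_pos hj (hθpos _ hm₀)).trans_le hcase
    refine ⟨l₀, hm₀, j / m l₀, by positivity, div_mul_cancel₀ _ hmpos.ne', ?_, ?_⟩
    · change j / m l₀ * θ l₀ ≤ 1
      rw [div_mul_eq_mul_div, div_le_one hmpos]; exact hcase
    · rw [hcgf₀]; simp
  · have hevent : ∀ᶠ l in 𝓝[<] βL, l₀ < l := nhdsWithin_le_nhds (lt_mem_nhds h0L)
    obtain ⟨l₂, ⟨hK, hl₂⟩, hl₂'⟩ := (((eventually_lt_cgf hL hR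
      (show 0 ≤ j * (βL - l₀) from (mul_pos hj (sub_pos.2 h0L)).le)).and hevent).and
      self_mem_nhdsWithin).exists
    have hm₂ : l₂ ∈ Set.Ico l₀ βL := ⟨hl₂.le, hl₂'⟩
    have hL₂ : logGen βL βR l₂ (cgf βL βR l₂) = 0 :=
      logGen_cgf hL hR (hdom _ hm₂) (logGen_zero_nonneg hL hR (hdom _ hm₂)
        (mul_nonneg (h0.trans hl₂.le) (sub_nonneg.2 (h0'.trans hl₂.le))))
    -- The tangent plane at l₂, evaluated at (l₀, 0) where `logGen` ≤ 0, yields `cgf` l₂ * θ l₂ ≤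
    -- (l₂ - l₀) * m l₂; with `cgf` l₂ ≥ j (βL - l₀) this gives m ≥ j θ at l₂.
    have hgrad := logGen_ge (hdom _ hm₂) (cgf_nonneg βL βR l₂) (hdom _ hm₀) le_rfl
    have hz := logGen_zero_nonpos hL hR (hdom _ hm₀) hprod.le
    have hge : j * θ l₂ ≤ m l₂ := by
      have h1 : (l₂ - l₀) * (j * θ l₂) ≤ (l₂ - l₀) * m l₂ := by
        have h2 : (l₂ - l₀) * (j * θ l₂) ≤ cgf βL βR l₂ * θ l₂ := by
          have : (l₂ - l₀) * j ≤ cgf βL βR l₂ := by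
            refine le_trans ?_ hK
            rw [mul_comm]
            exact mul_le_mul_of_nonneg_left (by linarith) hj.le
          rw [← mul_assoc]
          exact mul_le_mul_of_nonneg_right this (hθpos _ hm₂).le
        rw [hL₂] at hgrad
        simp only [hm, hθ] at h2 ⊢
        linarith
      exact le_of_mul_le_mul_left h1 (sub_pos.2 hl₂)
    have hcont : ContinuousOn (fun l => m l - j * θ l) (Set.Icc l₀ l₂) := fun l hl => by
      have hl' := hdom l ⟨hl.1, hl.2.trans_lt hl₂'⟩
      exact ((continuousAt_comp_cgf hL hR continuousOn_cycleCurrent hl').sub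
        ((continuousAt_comp_cgf hL hR continuousOn_cycleTime hl').const_mul j)).continuousWithinAt
    obtain ⟨l, hl, hzero⟩ := intermediate_value_Icc hl₂.le hcont
      (show (0 : ℝ) ∈ Set.Icc _ _ from ⟨by linarith, by linarith⟩)
    have hl' : l ∈ Set.Ico l₀ βL := ⟨hl.1, hl.2.trans_lt hl₂'⟩
    have hθl := hθpos l hl'
    refine ⟨l, hl', (θ l)⁻¹, by positivity, ?_, (inv_mul_cancel₀ hθl.ne').le, ?_⟩
    · change (θ l)⁻¹ * m l = j
      rw [show m l = j * θ l by linarith, mul_comm j, inv_mul_cancel_left₀ hθl.ne']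
    · change _ * ((θ l)⁻¹ * θ l) = _
      rw [inv_mul_cancel₀ hθl.ne', mul_one]

theorem approachable_of_pos (hL : 0 < βL) (hR : 0 < βR) {j : ℝ} (hj : 0 < j) :
    ∃ lam ∈ Set.Ioo (-βR) βL, ∀ δ, 0 < δ →
      Approachable βL βR j (lam * j - cgf βL βR lam) δ := by
  obtain ⟨l, hl, c, hc, hcj, hcθ, hsc⟩ := exists_optimal_tilt hL hR hj
  have h0 : 0 ≤ l := (le_max_left _ _).trans hl.1
  have h0' : βL - βR ≤ l := (le_max_right _ _).trans hl.1
  have hdom : l ∈ Set.Ioo (-βR) βL := ⟨by linarith, hl.2⟩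
  refine ⟨l, hdom, fun δ hδ => ?_⟩
  set r := l * j - cgf βL βR l with hr
  -- k is the fraction of cycles given up, so that they strictly fit in the available time. It is
  -- small enough for the losses k j and k |r| to stay below δ.
  obtain ⟨k, hk0, hk⟩ : ∃ k : ℝ, 0 < k ∧ k * (j + |r| + 1 + δ) < δ := by
    refine ⟨δ / (2 * (j + |r| + 1 + δ)), by positivity, ?_⟩
    rw [div_mul_eq_mul_div, div_lt_iff₀ (by positivity)]
    nlinarith [abs_nonneg r, mul_pos hδ hδ, mul_pos hδ hj, mul_nonneg hδ.le (abs_nonneg r)]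
  have hk1 : k < 1 := by nlinarith [abs_nonneg r]
  have hc' : 0 < (1 - k) * c := mul_pos (by linarith) hc
  have cm := continuousAt_comp_cgf hL hR continuousOn_cycleCurrent hdom
  have cθ := continuousAt_comp_cgf hL hR continuousOn_cycleTime hdom
  have cs := continuousAt_cgf hL hR hdom
  have e1 : ∀ᶠ x in 𝓝 l, (1 - k) * c * cycleTime βL βR x (cgf βL βR x) < 1 := by
    refine (cθ.const_mul ((1 - k) * c)).eventually (gt_mem_nhds ?_)
    dsimp only
    rw [mul_assoc]
    nlinarith
  have e2 : ∀ᶠ x in 𝓝 l, |(1 - k) * c * cycleCurrent βL βR x (cgf βL βR x) - j| < δ := by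
    refine ((cm.const_mul ((1 - k) * c)).sub_const j).abs.eventually (gt_mem_nhds ?_)
    dsimp only
    rw [mul_assoc, hcj, show (1 - k) * j - j = -(k * j) by ring, abs_neg,
      abs_of_pos (mul_pos hk0 hj)]
    nlinarith [mul_nonneg hk0.le (abs_nonneg r), mul_pos hk0 hδ]
  have e3 : ∀ᶠ x in 𝓝 l, (1 - k) * c * (x * cycleCurrent βL βR x (cgf βL βR x) -
      cgf βL βR x * cycleTime βL βR x (cgf βL βR x)) < r + δ := by
    refine (((continuousAt_id.mul cm).sub (cs.mul cθ)).const_mul ((1 - k) * c)).eventually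
      (gt_mem_nhds ?_)
    have : (1 - k) * c * (l * cycleCurrent βL βR l (cgf βL βR l) -
        cgf βL βR l * cycleTime βL βR l (cgf βL βR l)) = (1 - k) * r := by
      rw [hr, ← hcj]; linear_combination (k - 1) * hsc
    refine this.trans_lt ?_
    nlinarith [neg_abs_le r, mul_nonneg hk0.le (abs_nonneg r), mul_pos hk0 hδ, mul_pos hk0 hj,
      mul_le_mul_of_nonneg_left (neg_abs_le r) hk0.le]
  have e4 : ∀ᶠ x in 𝓝 l, x ∈ Set.Ioo (-βR) βL := isOpen_Ioo.mem_nhds hdom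
  -- The tilt is moved strictly to the right of l, where `cgf` > 0: the concentration estimate needs
  -- room on both sides of s.
  obtain ⟨x, ⟨⟨⟨⟨h1, h2⟩, h3⟩, h4⟩, h5⟩⟩ := (((((e1.and e2).and e3).and
    e4).filter_mono nhdsWithin_le_nhds).and (self_mem_nhdsWithin : Set.Ioi l ∈ 𝓝[>] l)).exists
  have hx : 0 < x * (x - (βL - βR)) :=
    mul_pos (h0.trans_lt h5) (sub_pos.2 (h0'.trans_lt h5))
  exact ⟨x, h4, cgf βL βR x, (1 - k) * c, cgf_pos hL hR h4 hx,
    logGen_cgf hL hR h4 (logGen_zero_pos hL hR h4 hx).le, hc', h1, h2, h3⟩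

theorem approachable_of_ne_zero (hL : 0 < βL) (hR : 0 < βR) {j : ℝ} (hj : j ≠ 0) :
    ∃ lam ∈ Set.Ioo (-βR) βL, ∀ δ, 0 < δ →
      Approachable βL βR j (lam * j - cgf βL βR lam) δ := by
  rcases hj.lt_or_gt with hneg | hpos
  · obtain ⟨l, hl, h⟩ := approachable_of_pos hL hR (neg_pos.2 hneg)
    have hdom : ∀ x ∈ Set.Ioo (-βR) βL, βL - βR - x ∈ Set.Ioo (-βR) βL :=
      fun x hx => ⟨by linarith [hx.2], by linarith [hx.1]⟩
    refine ⟨βL - βR - l, hdom l hl, fun δ hδ => ?_⟩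
    -- Reflection changes the cost by βL - βR times the error on the current, so the tolerance is
    -- divided by this factor.
    set k := 1 + |βL - βR| with hk
    have hk1 : 1 ≤ k := by linarith [abs_nonneg (βL - βR)]
    obtain ⟨x, hx, s, c, hs, hz, hc, hcθ, hcm, hcr⟩ := h (δ / k / 2) (by positivity)
    have hd1 : δ / k * k = δ := div_mul_cancel₀ _ (by positivity)
    have hd0 : 0 < δ / k := by positivity
    refine ⟨βL - βR - x, hdom x hx, s, c, hs, by rwa [logGen_symm], hc,
      by rwa [cycleTime_symm], ?_, ?_⟩
    · rw [cycleCurrent_symm, ← abs_neg]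
      have : δ / k / 2 < δ := by nlinarith
      refine lt_of_eq_of_lt ?_ (hcm.trans this)
      congr 1; ring
    · rw [cycleCurrent_symm, cycleTime_symm, cgf_symm]
      set m := cycleCurrent βL βR x s with hm
      have h1 : -((βL - βR) * (c * m - -j)) ≤ |βL - βR| * (δ / k / 2) := by
        refine (neg_le_abs _).trans ?_
        rw [abs_mul]
        exact mul_le_mul_of_nonneg_left hcm.le (abs_nonneg _)
      have h2 : |βL - βR| = k - 1 := by rw [hk]; ring
      rw [h2] at h1
      nlinarith
  · exact approachable_of_pos hL hR hpos

/-- The tangent plane of `logGen` at (0, 0), where it vanishes, evaluated at (lam, `cgf` lam); j* is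
the ratio of mean energy to mean duration of an untilted cycle. -/
theorem mul_meanCurrent_le_cgf (hL : 0 < βL) (hR : 0 < βR) {lam : ℝ}
    (hlam : lam ∈ Set.Ioo (-βR) βL) : lam * meanCurrent βL βR ≤ cgf βL βR lam := by
  have h0 : (0 : ℝ) ∈ Set.Ioo (-βR) βL := ⟨by linarith, hL⟩
  have h1 := logGen_ge h0 le_rfl hlam (cgf_nonneg βL βR lam)
  have h2 := logGen_cgf_le hL hR hlam
  have h3 : logGen βL βR 0 0 = 0 := by
    rw [logGen_zero hL hR h0]; simp [hL.ne', hR.ne']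
  have hθ := cycleTime_pos (βL := βL) (βR := βR) h0 le_rfl
  have h4 : meanCurrent βL βR = (cycleTime βL βR 0 0)⁻¹ * cycleCurrent βL βR 0 0 := by
    rw [meanCurrent, conductivity, cycleTime, cycleCurrent]
    simp only [sub_zero, add_zero]
    rw [meanKin_zero hL, meanKin_zero hR, meanTime_zero hL, meanTime_zero hR]
  rw [h4, ← mul_le_mul_iff_left₀ hθ]
  have : lam * ((cycleTime βL βR 0 0)⁻¹ * cycleCurrent βL βR 0 0) * cycleTime βL βR 0 0 =
      lam * cycleCurrent βL βR 0 0 := by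
    field_simp
  rw [this]
  linarith

end


/-! ### Integrals against the law of one flight -/

theorem flightLaw_eq (β : ℝ) :
    flightLaw β = (volume.restrict (Set.Ioi 0)).withDensity
      fun x => ENNReal.ofReal (β * boltz β 0 x) := by
  rw [flightLaw, ← withDensity_indicator measurableSet_Ioi]
  congr 1
  ext x
  by_cases hx : 0 < x
  · rw [if_pos hx, Set.indicator_of_mem (Set.mem_Ioi.2 hx), boltz, kin, zero_mul, add_zero]
    congr 1
    rw [mul_one_div, neg_div]; ring
  · rw [if_neg hx, Set.indicator_of_notMem (by simpa using hx), ENNReal.ofReal_zero]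

theorem lintegral_flightLaw (β : ℝ) {g : ℝ → ENNReal} (hg : Measurable g) :
    ∫⁻ x, g x ∂flightLaw β =
      ∫⁻ x in Set.Ioi 0, ENNReal.ofReal (β * boltz β 0 x) * g x := by
  rw [flightLaw_eq, lintegral_withDensity_eq_lintegral_mul _ _ hg]
  · rfl
  · exact (measurable_const.mul (measurable_boltz β 0)).ennreal_ofReal

theorem ae_pos_flightLaw (β : ℝ) : ∀ᵐ x ∂flightLaw β, 0 < x := by
  rw [flightLaw_eq]
  exact withDensity_absolutelyContinuous _ _ (ae_restrict_mem measurableSet_Ioi)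

theorem measurable_tilt (μ s : ℝ) :
    Measurable fun x => ENNReal.ofReal (Real.exp (μ * kin x - s * x)) := by
  have := measurable_kin
  fun_prop

theorem boltz_mul_exp (β μ s x : ℝ) :
    boltz β 0 x * Real.exp (μ * kin x - s * x) = boltz (β - μ) s x := by
  rw [boltz, boltz, mul_assoc, ← Real.exp_add]; congr 2; ring

theorem lintegral_tilt {β μ s : ℝ} (hβ : 0 < β) (hμ : μ < β) (hs : 0 ≤ s) :
    ∫⁻ x, ENNReal.ofReal (Real.exp (μ * kin x - s * x)) ∂flightLaw β =
      ENNReal.ofReal (β * partFn (β - μ) s) := by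
  rw [lintegral_flightLaw β (measurable_tilt μ s), partFn, boltzInt, ← integral_const_mul,
    ofReal_integral_eq_lintegral_ofReal
      ((tame_one.integrableOn (sub_pos.2 hμ) hs).const_mul β)]
  · refine setLIntegral_congr_fun measurableSet_Ioi fun x hx => ?_
    rw [← ENNReal.ofReal_mul (mul_nonneg hβ.le (boltz_pos β 0 hx).le), mul_assoc,
      boltz_mul_exp, one_mul]
  · refine (ae_restrict_iff' measurableSet_Ioi).2 (ae_of_all _ fun x hx => ?_)
    have := boltz_pos (β - μ) s hx
    simp only [Pi.zero_apply, one_mul]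
    positivity

/-- On (t, 2t), an interval of length t, the density is at least β exp (-β / 2) / (2t)³. Only the
polynomial order of this bound matters: long flights are free on the exponential scale. -/
theorem flightLaw_Ioi_ge {β t : ℝ} (hβ : 0 < β) (ht : 1 ≤ t) :
    ENNReal.ofReal (β * Real.exp (-(β / 2)) / 8 / t ^ 2) ≤ flightLaw β (Set.Ioi t) := by
  have h0 : 0 < t := by linarith
  rw [← setLIntegral_one, ← lintegral_indicator measurableSet_Ioi,
    lintegral_flightLaw β (measurable_const.indicator measurableSet_Ioi)]
  calc ENNReal.ofReal (β * Real.exp (-(β / 2)) / 8 / t ^ 2)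
      = ENNReal.ofReal (β * Real.exp (-(β / 2)) / (2 * t) ^ 3) * volume (Set.Ioo t (2 * t)) := by
        rw [Real.volume_Ioo, ← ENNReal.ofReal_mul (by positivity)]
        congr 1
        field_simp
        ring
    _ = ∫⁻ _ in Set.Ioo t (2 * t), ENNReal.ofReal (β * Real.exp (-(β / 2)) / (2 * t) ^ 3) := by
        rw [setLIntegral_const]
    _ ≤ ∫⁻ x in Set.Ioo t (2 * t),
          ENNReal.ofReal (β * boltz β 0 x) * (Set.Ioi t).indicator (fun _ => 1) x := by
        refine setLIntegral_mono' measurableSet_Ioo fun x hx => ?_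
        have hx0 : 0 < x := h0.trans hx.1
        rw [Set.indicator_of_mem (Set.mem_Ioi.2 hx.1), mul_one]
        refine ENNReal.ofReal_le_ofReal ?_
        rw [mul_div_assoc]
        refine mul_le_mul_of_nonneg_left ?_ hβ.le
        rw [boltz, div_eq_inv_mul]
        have h3 : x ^ 3 ≤ (2 * t) ^ 3 := pow_le_pow_left₀ hx0.le hx.2.le 3
        have hk : kin x ≤ 1 / 2 := by
          unfold kin
          have : (1 : ℝ) ≤ x ^ 2 := by nlinarith [hx.1]
          rw [div_le_div_iff₀ (by positivity) (by norm_num)]; linarith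
        gcongr
        nlinarith
    _ ≤ _ := lintegral_mono_set fun x hx => h0.trans hx.1

theorem measurable_restrictedTilt (μ u : ℝ) :
    Measurable ((Set.Ioo 0 u).indicator fun x => ENNReal.ofReal (Real.exp (μ * kin x))) := by
  have := measurable_kin
  exact Measurable.indicator (by fun_prop) measurableSet_Ioo

theorem lintegral_restrictedTilt {β : ℝ} (hβ : 0 < β) (μ u : ℝ) :
    ∫⁻ x, (Set.Ioo 0 u).indicator (fun x => ENNReal.ofReal (Real.exp (μ * kin x))) x
      ∂flightLaw β = ∫⁻ x in Set.Ioo 0 u, ENNReal.ofReal (β * boltz (β - μ) 0 x) := by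
  rw [lintegral_flightLaw β (measurable_restrictedTilt μ u),
    ← lintegral_indicator measurableSet_Ioi, ← lintegral_indicator measurableSet_Ioo]
  refine lintegral_congr fun x => ?_
  by_cases hx : x ∈ Set.Ioo 0 u
  · rw [Set.indicator_of_mem (Set.mem_Ioi.2 hx.1), Set.indicator_of_mem hx,
      Set.indicator_of_mem hx, ← ENNReal.ofReal_mul (mul_nonneg hβ.le (boltz_pos β 0 hx.1).le),
      mul_assoc, ← boltz_mul_exp β μ 0 x, zero_mul, sub_zero]
  · rw [Set.indicator_of_notMem hx]
    by_cases h0 : x ∈ Set.Ioi (0 : ℝ)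
    · rw [Set.indicator_of_mem h0, Set.indicator_of_notMem hx, mul_zero]
    · rw [Set.indicator_of_notMem h0]

theorem lintegral_restrictedTilt_ne_zero {β u : ℝ} (hβ : 0 < β) (μ : ℝ) (hu : 0 < u) :
    ∫⁻ x, (Set.Ioo 0 u).indicator (fun x => ENNReal.ofReal (Real.exp (μ * kin x))) x
      ∂flightLaw β ≠ 0 := by
  rw [lintegral_restrictedTilt hβ]
  refine (setLIntegral_pos_iff
    (measurable_const.mul (measurable_boltz _ 0)).ennreal_ofReal).2 ?_ |>.ne'
  refine lt_of_lt_of_le ?_ (measure_mono (show Set.Ioo 0 u ⊆ _ from fun x hx => ⟨?_, hx⟩))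
  · simpa using hu
  · simpa using mul_pos hβ (boltz_pos (β - μ) 0 hx.1)

/-- For β ≤ μ the Gaussian factor no longer compensates x⁻³ near 0: the integral over (0, e) is at
least β / e² for every small e. -/
theorem lintegral_restrictedTilt_eq_top {β μ u : ℝ} (hβ : 0 < β) (hμ : β ≤ μ) (hu : 0 < u) :
    ∫⁻ x, (Set.Ioo 0 u).indicator (fun x => ENNReal.ofReal (Real.exp (μ * kin x))) x
      ∂flightLaw β = ⊤ := by
  rw [lintegral_restrictedTilt hβ]
  refine ENNReal.eq_top_of_forall_nnreal_le fun r => ?_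
  obtain ⟨e, he0, heu, her⟩ : ∃ e : ℝ, 0 < e ∧ e ≤ u ∧ r * e ^ 2 ≤ β := by
    have h : Tendsto (fun e : ℝ => (r : ℝ) * e ^ 2) (𝓝[>] 0) (𝓝 0) := by
      have : Tendsto (fun e : ℝ => (r : ℝ) * e ^ 2) (𝓝 0) (𝓝 (r * 0 ^ 2)) :=
        Continuous.tendsto (by fun_prop) 0
      simp only [ne_eq, OfNat.ofNat_ne_zero, not_false_eq_true, zero_pow, mul_zero] at this
      exact this.mono_left nhdsWithin_le_nhds
    obtain ⟨e, ⟨h1, h2⟩, h3⟩ := (((h.eventually (gt_mem_nhds hβ)).and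
      ((gt_mem_nhds hu).filter_mono nhdsWithin_le_nhds)).and
      (self_mem_nhdsWithin : Set.Ioi (0 : ℝ) ∈ 𝓝[>] 0)).exists
    exact ⟨e, h3, h2.le, h1.le⟩
  calc (r : ENNReal) ≤ ENNReal.ofReal (β * (e ^ 3)⁻¹) * volume (Set.Ioo 0 e) := by
        rw [Real.volume_Ioo, ← ENNReal.ofReal_mul (by positivity), ← ENNReal.ofReal_coe_nnreal]
        refine ENNReal.ofReal_le_ofReal ?_
        have : β * (e ^ 3)⁻¹ * (e - 0) = β / e ^ 2 := by field_simp; ring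
        rw [this, le_div_iff₀ (by positivity)]
        exact her
    _ = ∫⁻ _ in Set.Ioo 0 e, ENNReal.ofReal (β * (e ^ 3)⁻¹) := by rw [setLIntegral_const]
    _ ≤ ∫⁻ x in Set.Ioo 0 e, ENNReal.ofReal (β * boltz (β - μ) 0 x) := by
        refine setLIntegral_mono' measurableSet_Ioo fun x hx => ?_
        refine ENNReal.ofReal_le_ofReal (mul_le_mul_of_nonneg_left ?_ hβ.le)
        have hx0 := hx.1
        have h3 : x ^ 3 ≤ e ^ 3 := pow_le_pow_left₀ hx0.le hx.2.le 3
        rw [boltz, ← mul_one (e ^ 3)⁻¹]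
        have : 1 ≤ Real.exp (-((β - μ) * kin x + 0 * x)) := by
          refine Real.one_le_exp ?_
          nlinarith [kin_pos hx0]
        gcongr
    _ ≤ _ := lintegral_mono_set (Set.Ioo_subset_Ioo_right heu)


/-! ### The current along a path as a finite sum of gains -/

/-- The signed energy carried by the flight that starts at the collision time `S_k`. -/
def gain {Ω : Type*} (p₀ : ℝ) (τ : ℕ → Ω → ℝ) (k : ℕ) (ω : Ω) : ℝ :=
  dir p₀ (k + 1) * kin (τ k ω)

theorem dir_succ (p₀ : ℝ) (k : ℕ) : dir p₀ (k + 1) = -dir p₀ k := by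
  rw [dir, dir, pow_succ]; ring

theorem dir_eq_one_or {p₀ : ℝ} (hp : p₀ ≠ 0) (k : ℕ) : dir p₀ k = 1 ∨ dir p₀ k = -1 := by
  induction k with
  | zero =>
    rcases hp.lt_or_gt with h | h
    · right; simp [dir, Real.sign_of_neg h]
    · left; simp [dir, Real.sign_of_pos h]
  | succ k ih =>
    rw [dir_succ]
    rcases ih with h | h <;> simp [h]

theorem wallBeta_pos {βL βR : ℝ} (hL : 0 < βL) (hR : 0 < βR) (σ : ℝ) : 0 < wallBeta βL βR σ := by
  unfold wallBeta; split_ifs <;> assumption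

theorem firstHit_nonneg {q₀ p₀ : ℝ} (hq : q₀ ∈ Set.Icc (0 : ℝ) 1) (hp : p₀ ≠ 0) :
    0 ≤ firstHit q₀ p₀ := by
  rcases hp.lt_or_gt with h | h
  · have : firstHit q₀ p₀ = -q₀ / p₀ := by
      rw [firstHit, dir, Real.sign_of_neg h]; norm_num
    rw [this]
    exact div_nonneg_of_nonpos (by linarith [hq.1]) h.le
  · have : firstHit q₀ p₀ = (1 - q₀) / p₀ := by
      rw [firstHit, dir, Real.sign_of_pos h]; norm_num
    rw [this]
    exact div_nonneg (by linarith [hq.2]) h.le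

section Paths

variable {Ω : Type*} {q₀ p₀ : ℝ} {τ : ℕ → Ω → ℝ} {t : ℝ} {ω : Ω}

theorem hitTime_succ (n : ℕ) : hitTime q₀ p₀ τ (n + 1) ω = hitTime q₀ p₀ τ n ω + τ n ω := by
  rw [hitTime, hitTime, Finset.sum_range_succ]; ring

theorem hitTime_mono (hτ : ∀ k, 0 < τ k ω) : Monotone fun n => hitTime q₀ p₀ τ n ω :=
  monotone_nat_of_le_succ fun n => by
    simp only [hitTime_succ]; linarith [hτ n]

theorem half_velocity_sq_mul_dir (hp : p₀ ≠ 0) (n : ℕ) :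
    1 / 2 * (velocity p₀ τ n ω ^ 2 * dir p₀ (n + 1)) = gain p₀ τ n ω := by
  have h : dir p₀ (n + 1) ^ 2 = 1 := by
    rcases dir_eq_one_or hp (n + 1) with h | h <;> simp [h]
  rw [velocity, gain, kin, div_pow, h]
  ring

theorem current_eq_tsum (hp : p₀ ≠ 0) : current q₀ p₀ τ t ω =
    ∑' n : ℕ, if hitTime q₀ p₀ τ (n + 1) ω ≤ t then gain p₀ τ n ω else 0 := by
  rw [current, ← tsum_mul_left]
  refine tsum_congr fun n => ?_
  rw [mul_ite, mul_zero, half_velocity_sq_mul_dir hp]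

theorem current_eq_sum (hp : p₀ ≠ 0) (hτ : ∀ k, 0 < τ k ω) {N : ℕ}
    (h1 : hitTime q₀ p₀ τ N ω ≤ t) (h2 : t < hitTime q₀ p₀ τ (N + 1) ω) :
    current q₀ p₀ τ t ω = ∑ k ∈ Finset.range N, gain p₀ τ k ω := by
  rw [current_eq_tsum hp, tsum_eq_sum (s := Finset.range N)]
  · refine Finset.sum_congr rfl fun k hk => if_pos ?_
    exact (hitTime_mono hτ (Finset.mem_range.1 hk)).trans h1
  · intro k hk
    refine if_neg (not_le.2 (h2.trans_le (hitTime_mono hτ ?_)))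
    have := Finset.mem_range.not.1 hk
    omega

theorem exists_window (hτ : Tendsto (fun n => hitTime q₀ p₀ τ n ω) atTop atTop)
    (ht : firstHit q₀ p₀ ≤ t) :
    ∃ N, hitTime q₀ p₀ τ N ω ≤ t ∧ t < hitTime q₀ p₀ τ (N + 1) ω := by
  classical
  have hex : ∃ n, t < hitTime q₀ p₀ τ n ω := (hτ.eventually_gt_atTop t).exists
  obtain ⟨N, hN⟩ : ∃ N, Nat.find hex = N + 1 := by
    refine Nat.exists_eq_succ_of_ne_zero fun h0 => ?_
    have := Nat.find_spec hex
    rw [h0] at this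
    simp [hitTime] at this
    linarith
  refine ⟨N, not_lt.1 (Nat.find_min hex (by omega)), ?_⟩
  have := Nat.find_spec hex
  rwa [hN] at this

end Paths

/-! ### Independent flights: product formulas and upper bounds for moments -/

section Law

variable {Ω : Type*} [MeasurableSpace Ω] {P : Measure Ω}
  {βL βR q₀ p₀ : ℝ} {τ : ℕ → Ω → ℝ}

theorem IsTracer.ae_pos (h : IsTracer P βL βR p₀ τ) : ∀ᵐ ω ∂P, ∀ k, 0 < τ k ω :=
  ae_all_iff.2 fun k =>
    ((h.law k).ae_iff (measurableSet_setOfPred.1 measurableSet_Ioi)).2 (ae_pos_flightLaw _)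

theorem IsTracer.lintegral_prod (h : IsTracer P βL βR p₀ τ) {G : ℕ → ℝ → ENNReal}
    (hG : ∀ k, Measurable (G k)) (N : ℕ) :
    ∫⁻ ω, ∏ k ∈ Finset.range N, G k (τ k ω) ∂P =
      ∏ k ∈ Finset.range N, ∫⁻ x, G k x ∂flightLaw (wallBeta βL βR (dir p₀ k)) := by
  have hae := fun k => (h.law k).aemeasurable
  -- The flight times are only almost everywhere measurable; the product formula is applied to
  -- measurable versions.
  set τ' : ℕ → Ω → ℝ := fun k => (hae k).mk (τ k) with hτ'
  have hind : iIndepFun τ' P := h.indep.congr fun k => (hae k).ae_eq_mk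
  have hmeas : ∀ k, Measurable (τ' k) := fun k => (hae k).measurable_mk
  have heq : ∀ᵐ ω ∂P, ∀ k, τ k ω = τ' k ω := ae_all_iff.2 fun k => (hae k).ae_eq_mk
  rw [lintegral_congr_ae (g := fun ω => ∏ k ∈ Finset.range N, G k (τ' k ω))
    (heq.mono fun ω hω => by simp only [hω]),
    lintegral_prod_eq_prod_lintegral_of_indepFun (Finset.range N) (fun k ω => G k (τ' k ω))
      (hind.comp G hG) fun k => (hG k).comp (hmeas k)]
  refine Finset.prod_congr rfl fun k _ => ?_
  rw [← (h.law k).map_eq, lintegral_map' (hG k).aemeasurable (hae k)]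
  exact lintegral_congr_ae ((hae k).ae_eq_mk.mono fun ω hω => by simp only [hτ', hω])

/-- The tilted mass `E[exp (lam x - s τ)]` of a single flight. -/
def flightGen (βL βR p₀ lam s : ℝ) (k : ℕ) : ENNReal :=
  ∫⁻ x, ENNReal.ofReal (Real.exp (lam * dir p₀ (k + 1) * kin x - s * x))
    ∂flightLaw (wallBeta βL βR (dir p₀ k))

theorem flightGen_of_dir_pos {lam s : ℝ} (hR : 0 < βR) (hlam : lam ∈ Set.Ioo (-βR) βL)
    (hs : 0 ≤ s) {k : ℕ} (hk : dir p₀ k = 1) :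
    flightGen βL βR p₀ lam s k = ENNReal.ofReal (βR * partFn (βR + lam) s) := by
  rw [flightGen, dir_succ, hk, wallBeta, if_pos one_pos,
    lintegral_tilt hR (by linarith [hlam.1]) hs]
  congr 3; ring

theorem flightGen_of_dir_neg {lam s : ℝ} (hL : 0 < βL) (hlam : lam ∈ Set.Ioo (-βR) βL)
    (hs : 0 ≤ s) {k : ℕ} (hk : dir p₀ k = -1) :
    flightGen βL βR p₀ lam s k = ENNReal.ofReal (βL * partFn (βL - lam) s) := by
  rw [flightGen, dir_succ, hk, wallBeta, if_neg (by norm_num),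
    lintegral_tilt hL (by linarith [hlam.2]) hs]
  congr 3; ring

/-- Consecutive flights leave opposite walls, so their product is the generating function of a cycle
whichever wall comes first; this removes the dependence on the sign of p₀. -/
theorem flightGen_mul_succ {lam s : ℝ} (hL : 0 < βL) (hR : 0 < βR) (hp : p₀ ≠ 0)
    (hlam : lam ∈ Set.Ioo (-βR) βL) (hs : 0 ≤ s) (k : ℕ) :
    flightGen βL βR p₀ lam s k * flightGen βL βR p₀ lam s (k + 1) =
      ENNReal.ofReal (Real.exp (logGen βL βR lam s)) := by
  have p1 := partFn_pos (sub_pos.2 hlam.2) hs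
  have p2 := partFn_pos (show 0 < βR + lam by linarith [hlam.1]) hs
  have h : Real.exp (logGen βL βR lam s) =
      βL * partFn (βL - lam) s * (βR * partFn (βR + lam) s) := by
    rw [logGen, Real.exp_add, Real.exp_add, Real.exp_log p1, Real.exp_log p2,
      Real.exp_log (by positivity)]
    ring
  rcases dir_eq_one_or hp k with hk | hk
  · rw [flightGen_of_dir_pos hR hlam hs hk, flightGen_of_dir_neg hL hlam hs
      (by rw [dir_succ, hk]), ← ENNReal.ofReal_mul (by positivity), h, mul_comm]
  · rw [flightGen_of_dir_neg hL hlam hs hk, flightGen_of_dir_pos hR hlam hs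
      (by rw [dir_succ, hk, neg_neg]), ← ENNReal.ofReal_mul (by positivity), h]

theorem flightGen_ne_top {lam s : ℝ} (hL : 0 < βL) (hR : 0 < βR) (hp : p₀ ≠ 0)
    (hlam : lam ∈ Set.Ioo (-βR) βL) (hs : 0 ≤ s) (k : ℕ) :
    flightGen βL βR p₀ lam s k ≠ ⊤ := by
  rcases dir_eq_one_or hp k with hk | hk
  · rw [flightGen_of_dir_pos hR hlam hs hk]; exact ENNReal.ofReal_ne_top
  · rw [flightGen_of_dir_neg hL hlam hs hk]; exact ENNReal.ofReal_ne_top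

theorem dir_two_mul (p₀ : ℝ) (n : ℕ) : dir p₀ (2 * n) = dir p₀ 0 := by
  simp [dir, pow_mul]

theorem prod_flightGen_even {lam s : ℝ} (hL : 0 < βL) (hR : 0 < βR) (hp : p₀ ≠ 0)
    (hlam : lam ∈ Set.Ioo (-βR) βL) (hs : 0 ≤ s) (n : ℕ) :
    ∏ k ∈ Finset.range (2 * n), flightGen βL βR p₀ lam s k =
      ENNReal.ofReal (Real.exp (logGen βL βR lam s)) ^ n := by
  induction n with
  | zero => simp
  | succ n ih =>
    rw [show 2 * (n + 1) = 2 * n + 1 + 1 by ring, Finset.prod_range_succ, Finset.prod_range_succ,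
      mul_assoc, flightGen_mul_succ hL hR hp hlam hs, ih, pow_succ]

theorem prod_ofReal_exp {Ω : Type*} {p₀ : ℝ} {τ : ℕ → Ω → ℝ} (lam s : ℝ) (N : ℕ) (ω : Ω) :
    ∏ k ∈ Finset.range N,
      ENNReal.ofReal (Real.exp (lam * dir p₀ (k + 1) * kin (τ k ω) - s * τ k ω)) =
    ENNReal.ofReal (Real.exp (lam * ∑ k ∈ Finset.range N, gain p₀ τ k ω -
      s * ∑ k ∈ Finset.range N, τ k ω)) := by
  rw [← ENNReal.ofReal_prod_of_nonneg fun _ _ => (Real.exp_pos _).le, ← Real.exp_sum,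
    Finset.mul_sum, Finset.mul_sum, ← Finset.sum_sub_distrib]
  simp only [gain, mul_assoc]

theorem IsTracer.lintegral_exp (h : IsTracer P βL βR p₀ τ) (lam s : ℝ) (N : ℕ) :
    ∫⁻ ω, ENNReal.ofReal (Real.exp (lam * ∑ k ∈ Finset.range N, gain p₀ τ k ω -
      s * ∑ k ∈ Finset.range N, τ k ω)) ∂P =
      ∏ k ∈ Finset.range N, flightGen βL βR p₀ lam s k := by
  simp only [← prod_ofReal_exp]
  exact h.lintegral_prod (G := fun k x =>
    ENNReal.ofReal (Real.exp (lam * dir p₀ (k + 1) * kin x - s * x)))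
    (fun k => measurable_tilt _ s) N

theorem IsTracer.lintegral_exp_mul_indicator (h : IsTracer P βL βR p₀ τ) (lam s t : ℝ) (N : ℕ) :
    ∫⁻ ω, ENNReal.ofReal (Real.exp (lam * ∑ k ∈ Finset.range N, gain p₀ τ k ω -
      s * ∑ k ∈ Finset.range N, τ k ω)) * (Set.Ioi t).indicator 1 (τ N ω) ∂P =
      (∏ k ∈ Finset.range N, flightGen βL βR p₀ lam s k) *
        flightLaw (wallBeta βL βR (dir p₀ N)) (Set.Ioi t) := by
  have hG : ∀ k, Measurable (fun x : ℝ => if k = N then (Set.Ioi t).indicator 1 x else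
      ENNReal.ofReal (Real.exp (lam * dir p₀ (k + 1) * kin x - s * x))) := fun k => by
    by_cases hk : k = N
    · simp only [hk, if_true]
      exact measurable_one.indicator measurableSet_Ioi
    · simp only [hk, if_false]
      exact measurable_tilt _ s
  have := h.lintegral_prod hG (N + 1)
  simp only [Finset.prod_range_succ, if_true] at this
  rw [lintegral_indicator_one measurableSet_Ioi] at this
  have hne : ∀ k ∈ Finset.range N, k ≠ N := fun k hk => (Finset.mem_range.1 hk).ne
  rw [Finset.prod_congr rfl fun k hk => by simp only [if_neg (hne k hk)]; rfl] at this
  refine Eq.trans (lintegral_congr fun ω => ?_) this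
  rw [← prod_ofReal_exp]
  congr 1
  exact Finset.prod_congr rfl fun k hk => (if_neg (hne k hk)).symm

/-- Grouping flights in pairs gives a geometric series of ratio below 1; odd N only adds one finite
factor. -/
theorem tsum_prod_flightGen_ne_top {lam s : ℝ} (hL : 0 < βL) (hR : 0 < βR) (hp : p₀ ≠ 0)
    (hlam : lam ∈ Set.Ioo (-βR) βL) (hs : 0 ≤ s) (hneg : logGen βL βR lam s < 0) :
    ∑' N, ∏ k ∈ Finset.range N, flightGen βL βR p₀ lam s k ≠ ⊤ := by
  have hgeom : ∑' n, ENNReal.ofReal (Real.exp (logGen βL βR lam s)) ^ n ≠ ⊤ := by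
    rw [ENNReal.tsum_geometric]
    refine ENNReal.inv_ne_top.2 (tsub_pos_of_lt ?_).ne'
    rw [← ENNReal.ofReal_one]
    exact (ENNReal.ofReal_lt_ofReal_iff one_pos).2 (Real.exp_lt_one_iff.2 hneg)
  rw [← tsum_even_add_odd ENNReal.summable ENNReal.summable]
  refine ENNReal.add_ne_top.2 ⟨?_, ?_⟩
  · simpa only [prod_flightGen_even hL hR hp hlam hs] using hgeom
  · have hper : ∀ n, flightGen βL βR p₀ lam s (2 * n) = flightGen βL βR p₀ lam s 0 := fun n => by
      simp only [flightGen, dir_succ, dir_two_mul]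
    simp only [Finset.prod_range_succ, prod_flightGen_even hL hR hp hlam hs, hper]
    rw [ENNReal.tsum_mul_right]
    exact ENNReal.mul_ne_top hgeom (flightGen_ne_top hL hR hp hlam hs 0)

theorem IsTracer.aemeasurable_gain (h : IsTracer P βL βR p₀ τ) (k : ℕ) :
    AEMeasurable (gain p₀ τ k) P :=
  (measurable_kin.comp_aemeasurable (h.law k).aemeasurable).const_mul _

theorem IsTracer.aemeasurable_tilt (h : IsTracer P βL βR p₀ τ) (lam s : ℝ) (N : ℕ) :
    AEMeasurable (fun ω => ENNReal.ofReal (Real.exp (lam * ∑ k ∈ Finset.range N, gain p₀ τ k ω -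
      s * ∑ k ∈ Finset.range N, τ k ω))) P := by
  refine AEMeasurable.ennreal_ofReal (Real.measurable_exp.comp_aemeasurable ?_)
  exact ((Finset.aemeasurable_fun_sum _ fun k _ => h.aemeasurable_gain k).const_mul _).sub
    ((Finset.aemeasurable_fun_sum _ fun k _ => (h.law k).aemeasurable).const_mul _)

/-- The sum over N of E exp (-T_N) is finite, hence exp (-T_N) tends to 0 almost surely. -/
theorem IsTracer.ae_tendsto_hitTime (h : IsTracer P βL βR p₀ τ) (hL : 0 < βL) (hR : 0 < βR)
    (hp : p₀ ≠ 0) : ∀ᵐ ω ∂P, Tendsto (fun n => hitTime q₀ p₀ τ n ω) atTop atTop := by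
  have h0 : (0 : ℝ) ∈ Set.Ioo (-βR) βL := ⟨by linarith, hL⟩
  have hneg : logGen βL βR 0 1 < 0 := by
    refine logGen_neg_of_cgf_lt hL hR h0 ?_
    rw [cgf_eq_zero hL hR h0 (by simp)]; exact one_pos
  have hint : ∫⁻ ω, ∑' N, ENNReal.ofReal (Real.exp (0 * ∑ k ∈ Finset.range N, gain p₀ τ k ω -
      1 * ∑ k ∈ Finset.range N, τ k ω)) ∂P ≠ ⊤ := by
    rw [lintegral_tsum fun N => h.aemeasurable_tilt 0 1 N]
    simp only [h.lintegral_exp]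
    exact tsum_prod_flightGen_ne_top hL hR hp h0 zero_le_one hneg
  have hae := ae_lt_top' (AEMeasurable.tsum fun N => h.aemeasurable_tilt 0 1 N) hint
  filter_upwards [hae] with ω hω
  have ht := ENNReal.tendsto_atTop_zero_of_tsum_ne_top hω.ne
  have h2 := (ENNReal.tendsto_toReal ENNReal.zero_ne_top).comp ht
  simp only [Function.comp_def, ENNReal.toReal_ofReal (Real.exp_pos _).le, ENNReal.toReal_zero,
    zero_mul, zero_sub, one_mul] at h2
  have h3 : Tendsto (fun N => -∑ k ∈ Finset.range N, τ k ω) atTop atBot :=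
    Real.tendsto_exp_comp_nhds_zero.1 h2
  exact tendsto_atTop_add_const_left _ _ (by simpa [Function.comp_def] using tendsto_neg_atBot_atTop.comp h3)

theorem IsTracer.aemeasurable_current (h : IsTracer P βL βR p₀ τ) (hL : 0 < βL) (hR : 0 < βR)
    (hp : p₀ ≠ 0) (t : ℝ) : AEMeasurable (current q₀ p₀ τ t) P := by
  have hit : ∀ n, AEMeasurable (hitTime q₀ p₀ τ n) P := fun n =>
    (Finset.aemeasurable_fun_sum _ fun k _ => (h.law k).aemeasurable).const_add _
  refine aemeasurable_of_tendsto_metrizable_ae atTop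
    (f := fun N ω => ∑ n ∈ Finset.range N,
      {ω | hitTime q₀ p₀ τ (n + 1) ω ≤ t}.indicator (gain p₀ τ n) ω) (fun N => ?_) ?_
  · exact Finset.aemeasurable_fun_sum _ fun n _ => (h.aemeasurable_gain n).indicator₀
      (nullMeasurableSet_le (hit (n + 1)) aemeasurable_const)
  · filter_upwards [h.ae_tendsto_hitTime (q₀ := q₀) hL hR hp] with ω hω
    rw [current_eq_tsum hp]
    refine HasSum.tendsto_sum_nat (f := fun n =>
      {ω | hitTime q₀ p₀ τ (n + 1) ω ≤ t}.indicator (gain p₀ τ n) ω) ?_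
    obtain ⟨M, hM⟩ := (hω.eventually_gt_atTop t).exists_forall_of_atTop
    refine Summable.hasSum (summable_of_hasFiniteSupport ((Set.finite_lt_nat M).subset fun n hn => ?_))
    by_contra hle
    exact hn (if_neg (not_le.2 (hM (n + 1) (by simp at hle; omega))))

/-- The exponential moments of the current grow at most at the rate `cgf`. -/
theorem IsTracer.exists_lintegral_exp_current_le (h : IsTracer P βL βR p₀ τ) (hL : 0 < βL)
    (hR : 0 < βR) (hq : q₀ ∈ Set.Icc (0 : ℝ) 1) (hp : p₀ ≠ 0) {lam s : ℝ}
    (hlam : lam ∈ Set.Ioo (-βR) βL) (hs : cgf βL βR lam < s) :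
    ∃ C : ENNReal, C ≠ ⊤ ∧ ∀ t, firstHit q₀ p₀ ≤ t →
      ∫⁻ ω, ENNReal.ofReal (Real.exp (lam * current q₀ p₀ τ t ω)) ∂P ≤
        ENNReal.ofReal (Real.exp (s * t)) * C := by
  have hs0 : 0 ≤ s := (cgf_nonneg βL βR lam).trans hs.le
  refine ⟨_, tsum_prod_flightGen_ne_top hL hR hp hlam hs0
    (logGen_neg_of_cgf_lt hL hR hlam hs), fun t ht => ?_⟩
  simp only [← h.lintegral_exp]
  rw [← lintegral_tsum fun N => h.aemeasurable_tilt lam s N,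
    ← lintegral_const_mul'' _ (AEMeasurable.tsum fun N => h.aemeasurable_tilt lam s N)]
  refine lintegral_mono_ae ?_
  filter_upwards [h.ae_tendsto_hitTime (q₀ := q₀) hL hR hp, h.ae_pos] with ω h1 h2
  obtain ⟨N, hN, hN'⟩ := exists_window h1 ht
  rw [current_eq_sum hp h2 hN hN']
  -- The number N of completed flights is random, so its term is bounded by the whole series. From
  -- T_N ≤ t and s ≥ 0, exp (lam X_N) ≤ exp (s t) exp (lam X_N - s T_N).
  refine le_trans ?_ (mul_le_mul_right (ENNReal.le_tsum N) _)
  rw [← ENNReal.ofReal_mul (Real.exp_pos _).le, ← Real.exp_add]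
  refine ENNReal.ofReal_le_ofReal (Real.exp_le_exp.2 ?_)
  have h3 : ∑ k ∈ Finset.range N, τ k ω ≤ t := by
    have := firstHit_nonneg hq hp
    rw [hitTime] at hN
    linarith
  nlinarith

/-- Outside the interval `(-βR, βL)` the exponential moments of the current are infinite. -/
theorem IsTracer.lintegral_exp_current_eq_top (h : IsTracer P βL βR p₀ τ) (hL : 0 < βL)
    (hR : 0 < βR) (hq : q₀ ∈ Set.Icc (0 : ℝ) 1) (hp : p₀ ≠ 0) {lam t : ℝ}
    (hlam : lam ∉ Set.Ioo (-βR) βL) (ht : max 1 (firstHit q₀ p₀) < t) :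
    ∫⁻ ω, ENNReal.ofReal (Real.exp (lam * current q₀ p₀ τ t ω)) ∂P = ⊤ := by
  have hS := firstHit_nonneg hq hp
  have ht1 : 1 < t := (le_max_left _ _).trans_lt ht
  -- Two flights shorter than u end before t; when the third exceeds t, the current is exactly the
  -- sum of the first two gains. These flights leave different walls, so one of them has an infinite
  -- moment whichever end of the domain lam violates.
  set u := (t - firstHit q₀ p₀) / 2 with hu
  have hu0 : 0 < u := by
    have := (le_max_right 1 (firstHit q₀ p₀)).trans_lt ht
    rw [hu]; linarith
  set A : ℕ → ENNReal := fun k => ∫⁻ x, (Set.Ioo 0 u).indicator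
    (fun x => ENNReal.ofReal (Real.exp (lam * dir p₀ (k + 1) * kin x))) x
    ∂flightLaw (wallBeta βL βR (dir p₀ k)) with hA
  have hA0 : ∀ k, A k ≠ 0 := fun k =>
    lintegral_restrictedTilt_ne_zero (wallBeta_pos hL hR _) _ hu0
  have hAtop : A 0 = ⊤ ∨ A 1 = ⊤ := by
    have key : ∀ k, (dir p₀ k = 1 ∧ lam ≤ -βR ∨ dir p₀ k = -1 ∧ βL ≤ lam) → A k = ⊤ := by
      rintro k (⟨hk, hl⟩ | ⟨hk, hl⟩)
      · refine lintegral_restrictedTilt_eq_top (wallBeta_pos hL hR _) ?_ hu0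
        rw [dir_succ, hk, wallBeta, if_pos one_pos]; linarith
      · refine lintegral_restrictedTilt_eq_top (wallBeta_pos hL hR _) ?_ hu0
        rw [dir_succ, hk, wallBeta, if_neg (by norm_num)]; linarith
    have h01 : dir p₀ 1 = -dir p₀ 0 := dir_succ p₀ 0
    have hcase : lam ≤ -βR ∨ βL ≤ lam := by
      by_contra! hc
      exact hlam hc
    rcases dir_eq_one_or hp 0 with h0 | h0 <;> rcases hcase with hl | hl
    · exact Or.inl (key 0 (Or.inl ⟨h0, hl⟩))
    · exact Or.inr (key 1 (Or.inr ⟨by rw [h01, h0], hl⟩))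
    · exact Or.inr (key 1 (Or.inl ⟨by rw [h01, h0, neg_neg], hl⟩))
    · exact Or.inl (key 0 (Or.inr ⟨h0, hl⟩))
  set G : ℕ → ℝ → ENNReal := fun k x => if k = 2 then (Set.Ioi t).indicator 1 x else
    (Set.Ioo 0 u).indicator
      (fun x => ENNReal.ofReal (Real.exp (lam * dir p₀ (k + 1) * kin x))) x with hGdef
  have hG : ∀ k, Measurable (G k) := fun k => by
    by_cases hk : k = 2
    · simp only [hGdef, hk, if_true]
      exact measurable_one.indicator measurableSet_Ioi
    · simp only [hGdef, hk, if_false]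
      exact measurable_restrictedTilt _ _
  have hprod := h.lintegral_prod hG 3
  have hrhs : ∏ k ∈ Finset.range 3, ∫⁻ x, G k x ∂flightLaw (wallBeta βL βR (dir p₀ k)) = ⊤ := by
    have e2 : ∫⁻ x, G 2 x ∂flightLaw (wallBeta βL βR (dir p₀ 2)) ≠ 0 := by
      simp only [hGdef, if_true]
      rw [lintegral_indicator_one measurableSet_Ioi]
      have hβ := wallBeta_pos hL hR (dir p₀ 2)
      refine (lt_of_lt_of_le ?_ (flightLaw_Ioi_ge hβ ht1.le)).ne'
      exact ENNReal.ofReal_pos.2 (by positivity)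
    have e0 : ∫⁻ x, G 0 x ∂flightLaw (wallBeta βL βR (dir p₀ 0)) = A 0 := by simp [hGdef, hA]
    have e1 : ∫⁻ x, G 1 x ∂flightLaw (wallBeta βL βR (dir p₀ 1)) = A 1 := by simp [hGdef, hA]
    rw [Finset.prod_range_succ, Finset.prod_range_succ, Finset.prod_range_one, e0, e1]
    refine (ENNReal.top_mul e2 ▸ ?_)
    congr 1
    rcases hAtop with h' | h'
    · rw [h', ENNReal.top_mul (hA0 1)]
    · rw [h', ENNReal.mul_top (hA0 0)]
  rw [hrhs] at hprod
  refine top_le_iff.1 (hprod ▸ lintegral_mono_ae ?_)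
  filter_upwards [h.ae_pos] with ω hω
  rw [Finset.prod_range_succ, Finset.prod_range_succ, Finset.prod_range_one]
  simp only [hGdef, if_true, show (0 : ℕ) ≠ 2 by norm_num, show (1 : ℕ) ≠ 2 by norm_num, if_false]
  by_cases hev : τ 0 ω ∈ Set.Ioo 0 u ∧ τ 1 ω ∈ Set.Ioo 0 u ∧ τ 2 ω ∈ Set.Ioi t
  · obtain ⟨h0, h1, h2⟩ := hev
    rw [Set.indicator_of_mem h0, Set.indicator_of_mem h1, Set.indicator_of_mem h2,
      Pi.one_apply, mul_one, ← ENNReal.ofReal_mul (Real.exp_pos _).le, ← Real.exp_add]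
    have e2 : hitTime q₀ p₀ τ 2 ω = firstHit q₀ p₀ + (τ 0 ω + τ 1 ω) := by
      simp [hitTime, Finset.sum_range_succ]
    rw [current_eq_sum hp hω (N := 2)]
    · simp only [Finset.sum_range_succ, Finset.sum_range_zero, gain]
      refine le_of_eq ?_
      congr 2; ring
    · rw [e2]
      have := h0.2
      have := h1.2
      linarith
    · rw [hitTime_succ, e2]
      have : t < τ 2 ω := h2
      linarith [hω 0, hω 1]
  · have : (Set.Ioo 0 u).indicator
        (fun x => ENNReal.ofReal (Real.exp (lam * dir p₀ (0 + 1) * kin x))) (τ 0 ω) *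
      (Set.Ioo 0 u).indicator
        (fun x => ENNReal.ofReal (Real.exp (lam * dir p₀ (1 + 1) * kin x))) (τ 1 ω) *
      (Set.Ioi t).indicator 1 (τ 2 ω) = 0 := by
      by_cases h0 : τ 0 ω ∈ Set.Ioo 0 u
      · by_cases h1 : τ 1 ω ∈ Set.Ioo 0 u
        · rw [Set.indicator_of_notMem fun h2 => hev ⟨h0, h1, h2⟩, mul_zero]
        · rw [Set.indicator_of_notMem h1, mul_zero, zero_mul]
      · rw [Set.indicator_of_notMem h0, zero_mul, zero_mul]
    rw [this]
    exact zero_le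

end Law


/-! ### Concentration of tilted cycles -/

section Chernoff

variable {βL βR : ℝ}

/-- Around a point where `logGen` vanishes, the exponents of the four Chernoff bounds for the
deviation of the cycle current and of the cycle time from their tilted means are negative. -/
theorem exists_chernoff {lam s δ : ℝ} (hlam : lam ∈ Set.Ioo (-βR) βL) (hs : 0 < s)
    (h0 : logGen βL βR lam s = 0) (hδ : 0 < δ) :
    ∃ η, 0 < η ∧ η ≤ s ∧ lam + η ∈ Set.Ioo (-βR) βL ∧ lam - η ∈ Set.Ioo (-βR) βL ∧
      logGen βL βR (lam + η) s - η * (cycleCurrent βL βR lam s + δ) < 0 ∧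
      logGen βL βR (lam - η) s + η * (cycleCurrent βL βR lam s - δ) < 0 ∧
      logGen βL βR lam (s - η) - η * (cycleTime βL βR lam s + δ) < 0 ∧
      logGen βL βR lam (s + η) + η * (cycleTime βL βR lam s - δ) < 0 := by
  have hopen : Set.Ioo (-βR) βL ×ˢ Set.Ioi 0 ∈ 𝓝 (lam, s) :=
    (isOpen_Ioo.prod isOpen_Ioi).mem_nhds ⟨hlam, hs⟩
  have hsub : Set.Ioo (-βR) βL ×ˢ Set.Ici 0 ∈ 𝓝 (lam, s) :=
    mem_of_superset hopen (Set.prod_mono_right Set.Ioi_subset_Ici_self)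
  have cm := continuousOn_cycleCurrent.continuousAt hsub
  have cθ := continuousOn_cycleTime.continuousAt hsub
  have path : ∀ a b : ℝ, Tendsto (fun η : ℝ => (lam + a * η, s + b * η)) (𝓝[>] 0) (𝓝 (lam, s)) := by
    intro a b
    have : Tendsto (fun η : ℝ => (lam + a * η, s + b * η)) (𝓝 0)
        (𝓝 (lam + a * 0, s + b * 0)) := Continuous.tendsto (by fun_prop) 0
    simp only [mul_zero, add_zero] at this
    exact this.mono_left nhdsWithin_le_nhds
  set m := cycleCurrent βL βR lam s with hm
  set θ := cycleTime βL βR lam s with hθ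
  have e1 := (cm.tendsto.comp (path 1 0)).eventually (gt_mem_nhds (show m < m + δ by linarith))
  have e2 := (cm.tendsto.comp (path (-1) 0)).eventually (lt_mem_nhds (show m - δ < m by linarith))
  have e3 := (cθ.tendsto.comp (path 0 (-1))).eventually (gt_mem_nhds (show θ < θ + δ by linarith))
  have e4 := (cθ.tendsto.comp (path 0 1)).eventually (lt_mem_nhds (show θ - δ < θ by linarith))
  have d1 : ∀ᶠ η : ℝ in 𝓝[>] 0, (lam + 1 * η, s + 0 * η) ∈ Set.Ioo (-βR) βL ×ˢ Set.Ioi 0 :=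
    path 1 0 hopen
  have d2 : ∀ᶠ η : ℝ in 𝓝[>] 0, (lam + -1 * η, s + -1 * η) ∈ Set.Ioo (-βR) βL ×ˢ Set.Ioi 0 :=
    path (-1) (-1) hopen
  obtain ⟨η, ⟨⟨⟨⟨⟨⟨h1, h2⟩, h3⟩, h4⟩, h5⟩, h6⟩, hη⟩⟩ := ((((((e1.and e2).and e3).and e4).and
    d1).and d2).and (self_mem_nhdsWithin : Set.Ioi (0 : ℝ) ∈ 𝓝[>] 0)).exists
  simp only [Function.comp, one_mul, zero_mul, add_zero, neg_mul, ← sub_eq_add_neg,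
    Set.mem_prod, Set.mem_Ioi] at h1 h2 h3 h4 h5 h6 hη
  -- Each tangent plane is taken at the perturbed point and evaluated at (lam, s), where `logGen` =
  -- 0. It bounds the perturbed value by η times a nearby mean, within δ of the mean at (lam, s) by
  -- continuity.
  have g1 := logGen_ge h5.1 hs.le hlam hs.le
  have g2 := logGen_ge h6.1 hs.le hlam hs.le
  have g3 := logGen_ge hlam h6.2.le hlam hs.le
  have g4 := logGen_ge (s := s + η) hlam (by linarith) hlam hs.le
  rw [h0] at g1 g2 g3 g4
  refine ⟨η, hη, by linarith [h6.2], h5.1, h6.1, ?_, ?_, ?_, ?_⟩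
  · nlinarith [mul_lt_mul_of_pos_left h1 hη]
  · nlinarith [mul_lt_mul_of_pos_left h2 hη]
  · nlinarith [mul_lt_mul_of_pos_left h3 hη]
  · nlinarith [mul_lt_mul_of_pos_left h4 hη]

/-- The bad event is a union of four half-planes, and on each of them one of the four exponents on
the right exceeds the one on the left. -/
theorem exp_le_of_not_concentrated {lam s X T η δ m θ n : ℝ} (hη : 0 < η)
    (h : ¬(|X - n * m| ≤ n * δ ∧ |T - n * θ| ≤ n * δ)) :
    Real.exp (lam * X - s * T) ≤
      Real.exp ((lam + η) * X - s * T) * Real.exp (-(n * (η * (m + δ)))) +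
      Real.exp ((lam - η) * X - s * T) * Real.exp (n * (η * (m - δ))) +
      Real.exp (lam * X - (s - η) * T) * Real.exp (-(n * (η * (θ + δ)))) +
      Real.exp (lam * X - (s + η) * T) * Real.exp (n * (η * (θ - δ))) := by
  simp only [← Real.exp_add]
  have key : ∀ {a b c d e : ℝ}, e ≤ a ∨ e ≤ b ∨ e ≤ c ∨ e ≤ d →
      Real.exp e ≤ Real.exp a + Real.exp b + Real.exp c + Real.exp d := by
    intro a b c d e h
    have := Real.exp_pos a
    have := Real.exp_pos b
    have := Real.exp_pos c
    have := Real.exp_pos d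
    rcases h with h | h | h | h <;> linarith [Real.exp_le_exp.2 h]
  apply key
  rw [abs_le, abs_le] at h
  by_contra! hc
  obtain ⟨c1, c2, c3, c4⟩ := hc
  refine h ⟨⟨?_, ?_⟩, ⟨?_, ?_⟩⟩ <;> refine le_of_mul_le_mul_left ?_ hη <;> linarith

end Chernoff

theorem lintegral_add_five {α : Type*} [MeasurableSpace α] {μ : Measure α} (f : α → ENNReal)
    {g₁ g₂ g₃ g₄ : α → ENNReal} (h₁ : AEMeasurable g₁ μ) (h₂ : AEMeasurable g₂ μ)
    (h₃ : AEMeasurable g₃ μ) (h₄ : AEMeasurable g₄ μ) :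
    ∫⁻ a, f a + (g₁ a + g₂ a + g₃ a + g₄ a) ∂μ =
      ∫⁻ a, f a ∂μ + (∫⁻ a, g₁ a ∂μ + ∫⁻ a, g₂ a ∂μ + ∫⁻ a, g₃ a ∂μ + ∫⁻ a, g₄ a ∂μ) := by
  rw [lintegral_add_right', lintegral_add_right', lintegral_add_right', lintegral_add_right']
  all_goals fun_prop

section Law

variable {Ω : Type*} [MeasurableSpace Ω] {P : Measure Ω} {βL βR q₀ p₀ : ℝ} {τ : ℕ → Ω → ℝ}

theorem IsTracer.lintegral_cycles (h : IsTracer P βL βR p₀ τ) (hL : 0 < βL) (hR : 0 < βR)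
    (hp : p₀ ≠ 0) {lam s : ℝ} (hlam : lam ∈ Set.Ioo (-βR) βL) (hs : 0 ≤ s) (t c : ℝ) (n : ℕ) :
    ∫⁻ ω, ENNReal.ofReal (Real.exp (lam * ∑ k ∈ Finset.range (2 * n), gain p₀ τ k ω -
      s * ∑ k ∈ Finset.range (2 * n), τ k ω) * Real.exp (n * c)) *
        (Set.Ioi t).indicator 1 (τ (2 * n) ω) ∂P =
      ENNReal.ofReal (Real.exp (n * (logGen βL βR lam s + c))) *
        flightLaw (wallBeta βL βR (dir p₀ (2 * n))) (Set.Ioi t) := by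
  have h1 : ∀ x : ℝ, ENNReal.ofReal (Real.exp x * Real.exp (n * c)) =
      ENNReal.ofReal (Real.exp (n * c)) * ENNReal.ofReal (Real.exp x) := fun x => by
    rw [mul_comm, ENNReal.ofReal_mul (Real.exp_pos _).le]
  simp only [h1, mul_assoc]
  rw [lintegral_const_mul' _ _ ENNReal.ofReal_ne_top, h.lintegral_exp_mul_indicator,
    prod_flightGen_even hL hR hp hlam hs, ← mul_assoc, ← ENNReal.ofReal_pow (Real.exp_pos _).le,
    ← ENNReal.ofReal_mul (Real.exp_pos _).le, ← Real.exp_nat_mul, ← Real.exp_add]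
  congr 3; ring

theorem IsTracer.aemeasurable_cycles (h : IsTracer P βL βR p₀ τ) (lam s t c : ℝ) (n N : ℕ) :
    AEMeasurable (fun ω => ENNReal.ofReal (Real.exp (lam * ∑ k ∈ Finset.range n, gain p₀ τ k ω -
      s * ∑ k ∈ Finset.range n, τ k ω) * Real.exp c) *
        (Set.Ioi t).indicator 1 (τ N ω)) P := by
  have h1 : ∀ x : ℝ, ENNReal.ofReal (Real.exp x * Real.exp c) =
      ENNReal.ofReal (Real.exp x) * ENNReal.ofReal (Real.exp c) := fun x =>
    ENNReal.ofReal_mul (Real.exp_pos _).le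
  simp only [h1]
  exact ((h.aemeasurable_tilt lam s n).mul_const _).mul
    ((measurable_one.indicator measurableSet_Ioi).comp_aemeasurable (h.law N).aemeasurable)

/-- The event that the first `n` cycles have nearly their tilted mean current and duration and are
followed by a flight longer than `t`. -/
def tiltedEvent (p₀ : ℝ) (τ : ℕ → Ω → ℝ) (m θ δ t : ℝ) (n : ℕ) : Set Ω :=
  {ω | (|∑ k ∈ Finset.range (2 * n), gain p₀ τ k ω - n * m| ≤ n * δ ∧
    |∑ k ∈ Finset.range (2 * n), τ k ω - n * θ| ≤ n * δ) ∧ t < τ (2 * n) ω}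

theorem IsTracer.eventually_flightLaw_le (h : IsTracer P βL βR p₀ τ) (hL : 0 < βL)
    (hR : 0 < βR) (hp : p₀ ≠ 0) [IsProbabilityMeasure P] {lam s δ : ℝ}
    (hlam : lam ∈ Set.Ioo (-βR) βL) (hs : 0 < s) (h0 : logGen βL βR lam s = 0) (hδ : 0 < δ) :
    ∀ᶠ n : ℕ in atTop, ∀ t, flightLaw (wallBeta βL βR (dir p₀ (2 * n))) (Set.Ioi t) / 2 ≤
      ENNReal.ofReal (Real.exp (n * (lam * cycleCurrent βL βR lam s - s * cycleTime βL βR lam s +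
        δ * (|lam| + s)))) *
      P (tiltedEvent p₀ τ (cycleCurrent βL βR lam s) (cycleTime βL βR lam s) δ t n) := by
  obtain ⟨η, hη, hηs, hd1, hd2, n1, n2, n3, n4⟩ := exists_chernoff hlam hs h0 hδ
  set m := cycleCurrent βL βR lam s with hm
  set θ := cycleTime βL βR lam s with hθ
  have hlim : ∀ {a : ℝ}, a < 0 → Tendsto (fun n : ℕ => Real.exp (n * a)) atTop (𝓝 0) :=
    fun {a} ha => Real.tendsto_exp_atBot.comp
      (tendsto_natCast_atTop_atTop.atTop_mul_const_of_neg ha)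
  have hsum := (((hlim n1).add (hlim n2)).add (hlim n3)).add (hlim n4)
  simp only [add_zero] at hsum
  filter_upwards [hsum.eventually (gt_mem_nhds (show (0 : ℝ) < 1 / 2 by norm_num))] with n hn t
  set p := flightLaw (wallBeta βL βR (dir p₀ (2 * n))) (Set.Ioi t) with hpdef
  set K := ENNReal.ofReal (Real.exp (n * (lam * m - s * θ + δ * (|lam| + s)))) with hK
  set E := tiltedEvent p₀ τ m θ δ t n with hE
  set D : ℝ → ℝ → ℝ → Ω → ENNReal := fun l r c ω =>
    ENNReal.ofReal (Real.exp (l * ∑ k ∈ Finset.range (2 * n), gain p₀ τ k ω -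
      r * ∑ k ∈ Finset.range (2 * n), τ k ω) * Real.exp (n * c)) *
        (Set.Ioi t).indicator 1 (τ (2 * n) ω) with hD
  have hDm : ∀ l r c, AEMeasurable (D l r c) P := fun l r c =>
    h.aemeasurable_cycles l r t (n * c) (2 * n) (2 * n)
  have hp1 : p ≤ 1 := by
    have := h.law (2 * n)
    have : IsProbabilityMeasure (flightLaw (wallBeta βL βR (dir p₀ (2 * n)))) :=
      this.isProbabilityMeasure_iff.1 ‹_›
    exact prob_le_one
  -- Change of measure without a new measure: the tilted weight, restricted to a final flight longer
  -- than t, has total mass p because `logGen` = 0. On the good event it is at most K; elsewhere it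
  -- is bounded by four weights of total mass at most p / 2 for large n.
  have hpoint : ∀ ω, D lam s 0 ω ≤ E.indicator (fun _ => K) ω +
      (D (lam + η) s (-(η * (m + δ))) ω + D (lam - η) s (η * (m - δ)) ω +
        D lam (s - η) (-(η * (θ + δ))) ω + D lam (s + η) (η * (θ - δ)) ω) := by
    intro ω
    set X := ∑ k ∈ Finset.range (2 * n), gain p₀ τ k ω with hX
    set T := ∑ k ∈ Finset.range (2 * n), τ k ω with hT
    by_cases ht : t < τ (2 * n) ω
    · by_cases hc : |X - n * m| ≤ n * δ ∧ |T - n * θ| ≤ n * δ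
      · refine le_add_right ?_
        rw [Set.indicator_of_mem (show ω ∈ E from ⟨hc, ht⟩)]
        simp only [hD, ← hX, ← hT]
        rw [Set.indicator_of_mem (Set.mem_Ioi.2 ht), Pi.one_apply, mul_one, mul_zero,
          Real.exp_zero, mul_one]
        refine ENNReal.ofReal_le_ofReal (Real.exp_le_exp.2 ?_)
        have a1 : lam * (X - n * m) ≤ |lam| * (n * δ) := by
          refine (le_abs_self _).trans ?_
          rw [abs_mul]
          exact mul_le_mul_of_nonneg_left hc.1 (abs_nonneg _)
        have a2 : s * -(T - n * θ) ≤ s * (n * δ) :=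
          mul_le_mul_of_nonneg_left ((neg_le_abs _).trans hc.2) hs.le
        nlinarith
      · refine le_add_left ?_
        simp only [hD, ← hX, ← hT]
        simp only [Set.indicator_of_mem (Set.mem_Ioi.2 ht), Pi.one_apply, mul_one, mul_zero,
          Real.exp_zero, mul_neg]
        rw [← ENNReal.ofReal_add (by positivity) (by positivity),
          ← ENNReal.ofReal_add (by positivity) (by positivity),
          ← ENNReal.ofReal_add (by positivity) (by positivity)]
        exact ENNReal.ofReal_le_ofReal (exp_le_of_not_concentrated hη hc)
    · have : D lam s 0 ω = 0 := by
        simp only [hD]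
        rw [Set.indicator_of_notMem (by simpa using ht), mul_zero]
      rw [this]; exact zero_le
  have hint := lintegral_mono (μ := P) hpoint
  have i0 := h.lintegral_cycles hL hR hp hlam hs.le t 0 n
  have i1 := h.lintegral_cycles hL hR hp hd1 hs.le t (-(η * (m + δ))) n
  have i2 := h.lintegral_cycles hL hR hp hd2 hs.le t (η * (m - δ)) n
  have i3 := h.lintegral_cycles hL hR hp hlam (sub_nonneg.2 hηs) t (-(η * (θ + δ))) n
  have i4 := h.lintegral_cycles hL hR hp hlam (by linarith : 0 ≤ s + η) t (η * (θ - δ)) n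
  have hone : ENNReal.ofReal (Real.exp (n * (logGen βL βR lam s + 0))) = 1 := by
    rw [h0, add_zero, mul_zero, Real.exp_zero, ENNReal.ofReal_one]
  rw [hone, one_mul] at i0
  rw [lintegral_add_five _ (hDm _ _ _) (hDm _ _ _) (hDm _ _ _) (hDm _ _ _)] at hint
  simp only [hD] at hint
  rw [i0, i1, i2, i3, i4, ← add_mul, ← add_mul, ← add_mul,
    ← ENNReal.ofReal_add (by positivity) (by positivity),
    ← ENNReal.ofReal_add (by positivity) (by positivity),
    ← ENNReal.ofReal_add (by positivity) (by positivity)] at hint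
  have hhalf : ENNReal.ofReal (1 / 2) * p = p / 2 := by
    rw [one_div, ENNReal.ofReal_inv_of_pos two_pos, mul_comm, ENNReal.div_eq_inv_mul, mul_comm]
    simp
  have hint2 : p / 2 + p / 2 ≤ K * P E + p / 2 := by
    rw [ENNReal.add_halves]
    refine hint.trans (add_le_add (lintegral_indicator_const_le E K) ?_)
    rw [← hhalf]
    refine mul_le_mul_left (ENNReal.ofReal_le_ofReal ?_) _
    rw [sub_eq_add_neg, sub_eq_add_neg (logGen βL βR lam (s - η))] at hn
    exact hn.le
  refine (ENNReal.add_le_add_iff_right ?_).1 hint2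
  exact (ENNReal.div_lt_top (hp1.trans_lt ENNReal.one_lt_top).ne two_ne_zero).ne

end Law


/-! ### Lower bounds for probabilities and moments -/

theorem eventually_exp_neg_le_div_sq {C b : ℝ} (hC : 0 < C) (hb : 0 < b) :
    ∀ᶠ t : ℝ in atTop, Real.exp (-(b * t)) ≤ C / t ^ 2 := by
  have h1 : Tendsto (fun t : ℝ => (b * t) ^ 2 * Real.exp (-(b * t))) atTop (𝓝 0) :=
    (Real.tendsto_pow_mul_exp_neg_atTop_nhds_zero 2).comp (tendsto_id.const_mul_atTop hb)
  filter_upwards [h1.eventually (gt_mem_nhds (show 0 < C * b ^ 2 by positivity)),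
    eventually_gt_atTop 0] with t ht ht0
  rw [le_div_iff₀ (by positivity)]
  have : b ^ 2 * (Real.exp (-(b * t)) * t ^ 2) < b ^ 2 * C := by nlinarith
  exact (lt_of_mul_lt_mul_left this (by positivity)).le

theorem exists_flightLaw_Ioi_ge {βL βR : ℝ} (hL : 0 < βL) (hR : 0 < βR) :
    ∃ C : ℝ, 0 < C ∧ ∀ σ t, 1 ≤ t →
      ENNReal.ofReal (C / t ^ 2) ≤ flightLaw (wallBeta βL βR σ) (Set.Ioi t) := by
  refine ⟨min (βL * Real.exp (-(βL / 2)) / 8) (βR * Real.exp (-(βR / 2)) / 8), by positivity,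
    fun σ t ht => le_trans (ENNReal.ofReal_le_ofReal ?_)
      (flightLaw_Ioi_ge (wallBeta_pos hL hR σ) ht)⟩
  gcongr
  unfold wallBeta
  split_ifs
  · exact min_le_right _ _
  · exact min_le_left _ _

section Law

variable {Ω : Type*} [MeasurableSpace Ω] {P : Measure Ω} {βL βR q₀ p₀ : ℝ} {τ : ℕ → Ω → ℝ}

/-- Not completing any flight has a subexponential cost. -/
theorem IsTracer.eventually_current_eq_zero (h : IsTracer P βL βR p₀ τ) (hL : 0 < βL)
    (hR : 0 < βR) (hq : q₀ ∈ Set.Icc (0 : ℝ) 1) (hp : p₀ ≠ 0) {ε : ℝ} (hε : 0 < ε) :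
    ∀ᶠ t in atTop, ENNReal.ofReal (Real.exp (-(ε * t))) ≤ P {ω | current q₀ p₀ τ t ω = 0} := by
  obtain ⟨C, hC, hCt⟩ := exists_flightLaw_Ioi_ge hL hR
  filter_upwards [eventually_exp_neg_le_div_sq hC hε, eventually_ge_atTop 1,
    eventually_ge_atTop (firstHit q₀ p₀)] with t h1 h2 h3
  calc ENNReal.ofReal (Real.exp (-(ε * t))) ≤ ENNReal.ofReal (C / t ^ 2) :=
        ENNReal.ofReal_le_ofReal h1
    _ ≤ flightLaw (wallBeta βL βR (dir p₀ 0)) (Set.Ioi t) := hCt _ t h2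
    _ = P {ω | t < τ 0 ω} := ((h.law 0).measure_eq measurableSet_Ioi).symm
    _ ≤ _ := by
        refine measure_mono_ae ?_
        filter_upwards [h.ae_pos] with ω hω ht
        refine current_eq_sum hp hω (N := 0) ?_ ?_
        · simpa [hitTime] using h3
        · have : t < τ 0 ω := ht
          have := firstHit_nonneg hq hp
          simp only [hitTime, zero_add, Finset.sum_range_one]
          linarith

/-- Running `c` tilted cycles per unit time, followed by a long flight. -/
theorem IsTracer.eventually_current_near (h : IsTracer P βL βR p₀ τ) [IsProbabilityMeasure P]
    (hL : 0 < βL) (hR : 0 < βR) (hq : q₀ ∈ Set.Icc (0 : ℝ) 1) (hp : p₀ ≠ 0) {lam s c ε : ℝ}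
    (hlam : lam ∈ Set.Ioo (-βR) βL) (hs : 0 < s) (h0 : logGen βL βR lam s = 0) (hc : 0 < c)
    (hcθ : c * cycleTime βL βR lam s < 1) (hε : 0 < ε) :
    ∀ᶠ t in atTop, ENNReal.ofReal (Real.exp (-((c * (lam * cycleCurrent βL βR lam s -
      s * cycleTime βL βR lam s) + ε) * t))) ≤
      P {ω | |current q₀ p₀ τ t ω - c * cycleCurrent βL βR lam s * t| ≤ ε * t} := by
  have hS := firstHit_nonneg hq hp
  set m := cycleCurrent βL βR lam s with hm
  set θ := cycleTime βL βR lam s with hθ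
  have hθ0 : 0 < θ := cycleTime_pos hlam hs.le
  -- Below 1 - c θ, the cycles still fit in time t with room for the first hit; below ε / 4, the
  -- errors on the current and on the cost stay within ε.
  obtain ⟨δ, hδ, hδ'⟩ : ∃ δ : ℝ, 0 < δ ∧ c * δ * (1 + (|lam| + s)) < min (1 - c * θ) (ε / 4) := by
    have hx : 0 < min (1 - c * θ) (ε / 4) := lt_min (by linarith) (by linarith)
    have hA : 0 < c * (1 + (|lam| + s)) := by positivity
    refine ⟨min (1 - c * θ) (ε / 4) / (c * (1 + (|lam| + s))) / 2, by positivity, ?_⟩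
    have : c * (min (1 - c * θ) (ε / 4) / (c * (1 + (|lam| + s))) / 2) * (1 + (|lam| + s)) =
        min (1 - c * θ) (ε / 4) / 2 := by field_simp
    rw [this]; linarith
  have hδ1 : c * δ < 1 - c * θ := by
    have := hδ'.trans_le (min_le_left _ _)
    have : 0 ≤ c * δ * (|lam| + s) := by positivity
    linarith
  have hδ2 : c * δ < ε / 4 := by
    have := hδ'.trans_le (min_le_right _ _)
    have : 0 ≤ c * δ * (|lam| + s) := by positivity
    linarith
  have hδ3 : c * δ * (|lam| + s) < ε / 4 := by
    have := hδ'.trans_le (min_le_right _ _)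
    have : 0 < c * δ := by positivity
    linarith
  set r := lam * m - s * θ with hr
  obtain ⟨C, hC, hCt⟩ := exists_flightLaw_Ioi_ge hL hR
  have hfloor : Tendsto (fun t : ℝ => ⌊c * t⌋₊) atTop atTop :=
    tendsto_nat_floor_atTop.comp (tendsto_id.const_mul_atTop hc)
  have hgap : 0 < 1 - c * (θ + δ) := by linarith
  filter_upwards [hfloor.eventually (h.eventually_flightLaw_le hL hR hp hlam hs h0 hδ),
    eventually_ge_atTop 1,
    eventually_exp_neg_le_div_sq (show 0 < C / 2 * Real.exp (-|r|) by positivity)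
      (show 0 < ε / 2 by positivity),
    eventually_ge_atTop (firstHit q₀ p₀ / (1 - c * (θ + δ))),
    eventually_ge_atTop (|m| / (ε / 2))] with t h1 h2 h3 h4 h5
  have ht0 : 0 < t := by linarith
  rw [div_le_iff₀ hgap] at h4
  rw [div_le_iff₀ (by positivity)] at h5
  -- Rounding loses less than one cycle: it changes the current by at most |m| and the exponent by
  -- at most |r|, both negligible for large t.
  set n := ⌊c * t⌋₊ with hn
  have hn1 : (n : ℝ) ≤ c * t := Nat.floor_le (by positivity)
  have hn2 : c * t < n + 1 := Nat.lt_floor_add_one _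
  have hn0 : (0 : ℝ) ≤ n := Nat.cast_nonneg n
  have hsub : P (tiltedEvent p₀ τ m θ δ t n) ≤
      P {ω | |current q₀ p₀ τ t ω - c * m * t| ≤ ε * t} := by
    refine measure_mono_ae ?_
    filter_upwards [h.ae_pos] with ω hω hE
    obtain ⟨⟨hX, hT⟩, hlong⟩ : (|∑ k ∈ Finset.range (2 * n), gain p₀ τ k ω - n * m| ≤ n * δ ∧
      |∑ k ∈ Finset.range (2 * n), τ k ω - n * θ| ≤ n * δ) ∧ t < τ (2 * n) ω := hE
    have hT' := (abs_le.1 hT).2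
    have hT0 : 0 ≤ ∑ k ∈ Finset.range (2 * n), τ k ω := Finset.sum_nonneg fun k _ => (hω k).le
    have hnθ : n * (θ + δ) ≤ c * t * (θ + δ) := by gcongr
    have hcur : current q₀ p₀ τ t ω = ∑ k ∈ Finset.range (2 * n), gain p₀ τ k ω := by
      refine current_eq_sum hp hω ?_ ?_
      · rw [hitTime]; linarith
      · rw [hitTime_succ, hitTime]; linarith
    change |current q₀ p₀ τ t ω - c * m * t| ≤ ε * t
    rw [hcur]
    have e1 : |(n : ℝ) * m - c * m * t| ≤ |m| := by
      have : (n : ℝ) * m - c * m * t = -((c * t - n) * m) := by ring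
      rw [this, abs_neg, abs_mul, abs_of_nonneg (by linarith)]
      exact mul_le_of_le_one_left (abs_nonneg _) (by linarith)
    have e2 : (n : ℝ) * δ ≤ ε / 4 * t := by
      have : (n : ℝ) * δ ≤ c * t * δ := by gcongr
      nlinarith
    have e3 := abs_sub_le (∑ k ∈ Finset.range (2 * n), gain p₀ τ k ω) (n * m) (c * m * t)
    nlinarith
  set A := (c * r + ε / 2) * t + |r| with hA
  have hexp : (n : ℝ) * (r + δ * (|lam| + s)) ≤ A := by
    have e1 : (n : ℝ) * r - c * t * r ≤ |r| := by
      have : (n : ℝ) * r - c * t * r = -((c * t - n) * r) := by ring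
      rw [this]
      refine (neg_le_abs _).trans ?_
      rw [abs_mul, abs_of_nonneg (by linarith)]
      exact mul_le_of_le_one_left (abs_nonneg _) (by linarith)
    have e2 : (n : ℝ) * (δ * (|lam| + s)) ≤ c * t * (δ * (|lam| + s)) := by gcongr
    nlinarith
  have hmain : ENNReal.ofReal (C / t ^ 2) / 2 ≤ ENNReal.ofReal (Real.exp A) *
      P {ω | |current q₀ p₀ τ t ω - c * m * t| ≤ ε * t} :=
    calc ENNReal.ofReal (C / t ^ 2) / 2
        ≤ flightLaw (wallBeta βL βR (dir p₀ (2 * n))) (Set.Ioi t) / 2 :=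
          ENNReal.div_le_div_right (hCt _ t h2) 2
      _ ≤ _ := h1 t
      _ ≤ _ := mul_le_mul' (ENNReal.ofReal_le_ofReal (Real.exp_le_exp.2 hexp)) hsub
  have hmul : ENNReal.ofReal (Real.exp (-A)) * (ENNReal.ofReal (Real.exp A) *
      P {ω | |current q₀ p₀ τ t ω - c * m * t| ≤ ε * t}) =
      P {ω | |current q₀ p₀ τ t ω - c * m * t| ≤ ε * t} := by
    rw [← mul_assoc, ← ENNReal.ofReal_mul (Real.exp_pos _).le, ← Real.exp_add, neg_add_cancel,
      Real.exp_zero, ENNReal.ofReal_one, one_mul]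
  rw [← hmul]
  refine le_trans ?_ (mul_le_mul_right hmain _)
  have htwo : ENNReal.ofReal (C / t ^ 2) / 2 = ENNReal.ofReal (C / t ^ 2 / 2) := by
    rw [ENNReal.ofReal_div_of_pos two_pos]; simp
  rw [htwo, ← ENNReal.ofReal_mul (Real.exp_pos _).le]
  refine ENNReal.ofReal_le_ofReal ?_
  have e1 : Real.exp (-((c * r + ε) * t)) =
      Real.exp (-A) * (Real.exp |r| * Real.exp (-(ε / 2 * t))) := by
    rw [← Real.exp_add, ← Real.exp_add]; congr 1; rw [hA]; ring
  rw [e1]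
  refine mul_le_mul_of_nonneg_left ?_ (Real.exp_pos _).le
  calc Real.exp |r| * Real.exp (-(ε / 2 * t))
      ≤ Real.exp |r| * (C / 2 * Real.exp (-|r|) / t ^ 2) := by gcongr
    _ = Real.exp |r| * Real.exp (-|r|) * (C / t ^ 2 / 2) := by ring
    _ = C / t ^ 2 / 2 := by rw [← Real.exp_add, add_neg_cancel, Real.exp_zero, one_mul]

/-- The exponential moments of the current grow at least at the rate `cgf`. -/
theorem IsTracer.eventually_le_lintegral_exp_current (h : IsTracer P βL βR p₀ τ)
    [IsProbabilityMeasure P] (hL : 0 < βL) (hR : 0 < βR) (hq : q₀ ∈ Set.Icc (0 : ℝ) 1)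
    (hp : p₀ ≠ 0) {lam ε : ℝ} (hlam : lam ∈ Set.Ioo (-βR) βL) (hε : 0 < ε) :
    ∀ᶠ t in atTop, ENNReal.ofReal (Real.exp ((cgf βL βR lam - ε) * t)) ≤
      ∫⁻ ω, ENNReal.ofReal (Real.exp (lam * current q₀ p₀ τ t ω)) ∂P := by
  have hmeas : ∀ t, AEMeasurable
      (fun ω => ENNReal.ofReal (Real.exp (lam * current q₀ p₀ τ t ω))) P := fun t =>
    (Real.measurable_exp.comp_aemeasurable
      ((h.aemeasurable_current hL hR hp t).const_mul lam)).ennreal_ofReal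
  have markov : ∀ (t a b : ℝ) (E : Set Ω), ENNReal.ofReal (Real.exp (-(b * t))) ≤ P E →
      (∀ ω ∈ E, a * t ≤ lam * current q₀ p₀ τ t ω) →
      ENNReal.ofReal (Real.exp ((a - b) * t)) ≤
        ∫⁻ ω, ENNReal.ofReal (Real.exp (lam * current q₀ p₀ τ t ω)) ∂P := by
    intro t a b E hE hle
    refine le_trans ?_ (mul_meas_ge_le_lintegral₀ (hmeas t) (ENNReal.ofReal (Real.exp (a * t))))
    rw [show (a - b) * t = a * t + -(b * t) by ring, Real.exp_add,
      ENNReal.ofReal_mul (Real.exp_pos _).le]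
    refine mul_le_mul_right (hE.trans (measure_mono fun ω hω => ?_)) _
    exact ENNReal.ofReal_le_ofReal (Real.exp_le_exp.2 (hle ω hω))
  -- When `cgf` = 0, the event that no flight is completed already suffices. Otherwise the cycles
  -- occupy a fraction 1 - k of the time at s = `cgf`, and the net exponent is s (1 - k) up to ε /
  -- 2.
  rcases (cgf_nonneg βL βR lam).eq_or_lt with hz | hpos
  · filter_upwards [h.eventually_current_eq_zero hL hR hq hp hε] with t ht
    rw [← hz]
    refine markov t 0 ε _ ht fun ω hω => ?_
    have : current q₀ p₀ τ t ω = 0 := hω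
    rw [this]; simp
  · set s := cgf βL βR lam with hs
    have h0 : logGen βL βR lam s = 0 :=
      logGen_cgf hL hR hlam (logGen_pos_of_lt_cgf le_rfl hpos).le
    have hθ := cycleTime_pos hlam hpos.le
    set m := cycleCurrent βL βR lam s with hm
    set θ := cycleTime βL βR lam s with hθdef
    obtain ⟨k, hk0, hk1, hks⟩ : ∃ k : ℝ, 0 < k ∧ k < 1 ∧ k * s ≤ ε / 2 := by
      refine ⟨min (1 / 2) (ε / 2 / s), by positivity,
        (min_le_left _ _).trans_lt (by norm_num), ?_⟩
      calc min (1 / 2) (ε / 2 / s) * s ≤ ε / 2 / s * s := by gcongr; exact min_le_right _ _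
        _ = ε / 2 := div_mul_cancel₀ _ hpos.ne'
    set c := (1 - k) / θ with hc
    have hcθ : c * θ = 1 - k := div_mul_cancel₀ _ hθ.ne'
    have hc0 : 0 < c := div_pos (by linarith) hθ
    set e := ε / 2 / (|lam| + 1) with he
    have he0 : 0 < e := by positivity
    have hee : e * (|lam| + 1) = ε / 2 := div_mul_cancel₀ _ (by positivity)
    filter_upwards [h.eventually_current_near (q₀ := q₀) hL hR hq hp hlam hpos h0 hc0
      (by rw [← hθdef, hcθ]; linarith) he0, eventually_gt_atTop 0] with t ht ht0
    refine le_trans ?_ (markov t (lam * c * m - |lam| * e) _ _ ht fun ω hω => ?_)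
    · refine ENNReal.ofReal_le_ofReal (Real.exp_le_exp.2 ?_)
      refine mul_le_mul_of_nonneg_right ?_ ht0.le
      have : c * (lam * m - s * θ) = lam * c * m - s * (1 - k) := by rw [← hcθ]; ring
      rw [← hm, ← hθdef, this]
      nlinarith
    · have hω' : |current q₀ p₀ τ t ω - c * m * t| ≤ e * t := hω
      have h1 : -(lam * (current q₀ p₀ τ t ω - c * m * t)) ≤ |lam| * (e * t) := by
        refine (neg_le_abs _).trans ?_
        rw [abs_mul]
        exact mul_le_mul_of_nonneg_left hω' (abs_nonneg _)
      nlinarith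

/-- Local lower bound: the cost of the current `x` is at most `lam * x - cgf lam` for some `lam`. -/
theorem IsTracer.exists_eventually_current_near (h : IsTracer P βL βR p₀ τ)
    [IsProbabilityMeasure P] (hL : 0 < βL) (hR : 0 < βR) (hq : q₀ ∈ Set.Icc (0 : ℝ) 1)
    (hp : p₀ ≠ 0) (x : ℝ) :
    ∃ lam ∈ Set.Ioo (-βR) βL, ∀ ρ > 0, ∀ r > lam * x - cgf βL βR lam,
      ∀ᶠ t in atTop, ENNReal.ofReal (Real.exp (-(r * t))) ≤
        P {ω | |current q₀ p₀ τ t ω - x * t| < ρ * t} := by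
  rcases eq_or_ne x 0 with rfl | hx
  · have h0 : (0 : ℝ) ∈ Set.Ioo (-βR) βL := ⟨by linarith, hL⟩
    refine ⟨0, h0, fun ρ hρ r hr => ?_⟩
    rw [cgf_eq_zero hL hR h0 (by simp)] at hr
    filter_upwards [h.eventually_current_eq_zero hL hR hq hp (show 0 < r by simpa using hr),
      eventually_gt_atTop 0] with t ht ht0
    refine ht.trans (measure_mono fun ω hω => ?_)
    have : current q₀ p₀ τ t ω = 0 := hω
    change |current q₀ p₀ τ t ω - 0 * t| < ρ * t
    rw [this]; simpa using mul_pos hρ ht0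
  · obtain ⟨l, hl, happ⟩ := approachable_of_ne_zero hL hR hx
    refine ⟨l, hl, fun ρ hρ r hr => ?_⟩
    set e := min (ρ / 2) ((r - (l * x - cgf βL βR l)) / 2) with he
    have he0 : 0 < e := lt_min (by linarith) (by linarith)
    have he1 : e ≤ ρ / 2 := min_le_left _ _
    have he2 : e ≤ (r - (l * x - cgf βL βR l)) / 2 := min_le_right _ _
    obtain ⟨l', hl', s, c, hs, hz, hc, hcθ, hcm, hcr⟩ := happ e he0
    filter_upwards [h.eventually_current_near (q₀ := q₀) hL hR hq hp hl' hs hz hc hcθ he0,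
      eventually_gt_atTop 0] with t ht ht0
    refine le_trans (ENNReal.ofReal_le_ofReal (Real.exp_le_exp.2 (neg_le_neg ?_)))
      (ht.trans (measure_mono fun ω hω => ?_))
    · exact mul_le_mul_of_nonneg_right (by linarith) ht0.le
    · have hω' : |current q₀ p₀ τ t ω - c * cycleCurrent βL βR l' s * t| ≤ e * t := hω
      change |current q₀ p₀ τ t ω - x * t| < ρ * t
      have e1 := abs_sub_le (current q₀ p₀ τ t ω) (c * cycleCurrent βL βR l' s * t) (x * t)
      have e2 : |c * cycleCurrent βL βR l' s * t - x * t| < e * t := by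
        rw [← sub_mul, abs_mul, abs_of_pos ht0]
        exact mul_lt_mul_of_pos_right hcm ht0
      nlinarith

/-! ### Upper bounds for moments and probabilities at large times -/

theorem eventually_le_ofReal_exp {C : ENNReal} (hC : C ≠ ⊤) {ε : ℝ} (hε : 0 < ε) :
    ∀ᶠ t : ℝ in atTop, C ≤ ENNReal.ofReal (Real.exp (ε * t)) := by
  have h : Tendsto (fun t : ℝ => ENNReal.ofReal (Real.exp (ε * t))) atTop (𝓝 ⊤) :=
    ENNReal.tendsto_ofReal_nhds_top.2
      (Real.tendsto_exp_atTop.comp (tendsto_id.const_mul_atTop hε))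
  filter_upwards [h.eventually (lt_mem_nhds hC.lt_top)] with t ht
  exact ht.le

/-- Any slack in the exponent absorbs constants. The factor K later provides the 2 needed to add the
bounds for two half-lines. -/
theorem IsTracer.eventually_lintegral_exp_current_le (h : IsTracer P βL βR p₀ τ) (hL : 0 < βL)
    (hR : 0 < βR) (hq : q₀ ∈ Set.Icc (0 : ℝ) 1) (hp : p₀ ≠ 0) {lam s : ℝ}
    (hlam : lam ∈ Set.Ioo (-βR) βL) (hs : cgf βL βR lam < s) (K : ENNReal) (hK : K ≠ ⊤) :
    ∀ᶠ t in atTop, K * ∫⁻ ω, ENNReal.ofReal (Real.exp (lam * current q₀ p₀ τ t ω)) ∂P ≤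
      ENNReal.ofReal (Real.exp (s * t)) := by
  obtain ⟨s', h1, h2⟩ := exists_between hs
  obtain ⟨C, hC, hbound⟩ := h.exists_lintegral_exp_current_le hL hR hq hp hlam h1
  filter_upwards [eventually_le_ofReal_exp (ENNReal.mul_ne_top hK hC) (sub_pos.2 h2),
    eventually_ge_atTop (firstHit q₀ p₀)] with t ht ht'
  calc _ ≤ K * (ENNReal.ofReal (Real.exp (s' * t)) * C) := mul_le_mul_right (hbound t ht') _
    _ = ENNReal.ofReal (Real.exp (s' * t)) * (K * C) := by ring
    _ ≤ ENNReal.ofReal (Real.exp (s' * t)) * ENNReal.ofReal (Real.exp ((s - s') * t)) :=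
      mul_le_mul_right ht _
    _ = _ := by
      rw [← ENNReal.ofReal_mul (Real.exp_pos _).le, ← Real.exp_add]; congr 2; ring

/-- Chernoff's bound for the current. -/
theorem IsTracer.eventually_measure_le (h : IsTracer P βL βR p₀ τ) (hL : 0 < βL)
    (hR : 0 < βR) (hq : q₀ ∈ Set.Icc (0 : ℝ) 1) (hp : p₀ ≠ 0) {lam x r : ℝ}
    (hlam : lam ∈ Set.Ioo (-βR) βL) (hr : r < lam * x - cgf βL βR lam) :
    ∀ᶠ t in atTop, 2 * P {ω | lam * x * t ≤ lam * current q₀ p₀ τ t ω} ≤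
      ENNReal.ofReal (Real.exp (-(r * t))) := by
  filter_upwards [h.eventually_lintegral_exp_current_le hL hR hq hp hlam
    (show cgf βL βR lam < lam * x - r by linarith) 2 (by simp)] with t ht
  have hmeas : AEMeasurable
      (fun ω => ENNReal.ofReal (Real.exp (lam * current q₀ p₀ τ t ω))) P :=
    (Real.measurable_exp.comp_aemeasurable
      ((h.aemeasurable_current hL hR hp t).const_mul lam)).ennreal_ofReal
  have hm := mul_meas_ge_le_lintegral₀ hmeas (ENNReal.ofReal (Real.exp (lam * x * t)))
  have hset : P {ω | lam * x * t ≤ lam * current q₀ p₀ τ t ω} ≤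
      P {ω | ENNReal.ofReal (Real.exp (lam * x * t)) ≤
        ENNReal.ofReal (Real.exp (lam * current q₀ p₀ τ t ω))} :=
    measure_mono fun ω hω => ENNReal.ofReal_le_ofReal (Real.exp_le_exp.2 hω)
  have hone : ENNReal.ofReal (Real.exp (-(lam * x * t))) *
      ENNReal.ofReal (Real.exp (lam * x * t)) = 1 := by
    rw [← ENNReal.ofReal_mul (Real.exp_pos _).le, ← Real.exp_add, neg_add_cancel, Real.exp_zero,
      ENNReal.ofReal_one]
  calc 2 * P {ω | lam * x * t ≤ lam * current q₀ p₀ τ t ω}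
      = ENNReal.ofReal (Real.exp (-(lam * x * t))) * (2 * (ENNReal.ofReal (Real.exp (lam * x * t)) *
          P {ω | lam * x * t ≤ lam * current q₀ p₀ τ t ω})) := by
        rw [mul_left_comm 2, ← mul_assoc, hone, one_mul]
    _ ≤ ENNReal.ofReal (Real.exp (-(lam * x * t))) *
          ENNReal.ofReal (Real.exp ((lam * x - r) * t)) := by
        refine mul_le_mul_right (le_trans (mul_le_mul_right ?_ _) ht) _
        exact (mul_le_mul_right hset _).trans hm
    _ = _ := by
      rw [← ENNReal.ofReal_mul (Real.exp_pos _).le, ← Real.exp_add]; congr 2; ring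

end Law


/-! ### The rate function: Legendre transform and flat pieces -/

theorem le_log_div {x : ENNReal} {a t : ℝ} (ht : 0 < t)
    (h : ENNReal.ofReal (Real.exp (a * t)) ≤ x) : (a : EReal) ≤ ENNReal.log x / (t : EReal) := by
  rw [EReal.le_div_iff_mul_le (by exact_mod_cast ht) (EReal.coe_ne_top t), ← EReal.coe_mul,
    ← Real.log_exp (a * t), ← ENNReal.log_ofReal_of_pos (Real.exp_pos _)]
  exact ENNReal.log_monotone h

theorem log_div_le {x : ENNReal} {a t : ℝ} (ht : 0 < t)
    (h : x ≤ ENNReal.ofReal (Real.exp (a * t))) : ENNReal.log x / (t : EReal) ≤ a := by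
  rw [EReal.div_le_iff_le_mul (by exact_mod_cast ht) (EReal.coe_ne_top t), mul_comm,
    ← EReal.coe_mul, ← Real.log_exp (a * t), ← ENNReal.log_ofReal_of_pos (Real.exp_pos _)]
  exact ENNReal.log_monotone h

/-- The cumulant generating function of the current, with values in `[0, ∞]`. -/
def cgfExt (βL βR lam : ℝ) : EReal :=
  open Classical in if lam ∈ Set.Ioo (-βR) βL then (cgf βL βR lam : EReal) else ⊤

section Legendre

variable {βL βR : ℝ}

theorem cgfExt_of_mem {lam : ℝ} (h : lam ∈ Set.Ioo (-βR) βL) :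
    cgfExt βL βR lam = (cgf βL βR lam : EReal) := if_pos h

theorem cgfExt_of_notMem {lam : ℝ} (h : lam ∉ Set.Ioo (-βR) βL) : cgfExt βL βR lam = ⊤ := if_neg h

theorem le_legendre {lam : ℝ} (h : lam ∈ Set.Ioo (-βR) βL) (j : ℝ) :
    ((lam * j - cgf βL βR lam : ℝ) : EReal) ≤ legendre (cgfExt βL βR) j := by
  have := le_iSup (fun l : ℝ => ((l * j : ℝ) : EReal) - cgfExt βL βR l) lam
  simp only [cgfExt_of_mem h] at this
  rwa [EReal.coe_sub]

theorem legendre_le {j : ℝ} {r : EReal}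
    (h : ∀ lam ∈ Set.Ioo (-βR) βL, ((lam * j - cgf βL βR lam : ℝ) : EReal) ≤ r) :
    legendre (cgfExt βL βR) j ≤ r := by
  refine iSup_le fun lam => ?_
  by_cases hl : lam ∈ Set.Ioo (-βR) βL
  · rw [cgfExt_of_mem hl, ← EReal.coe_sub]; exact h lam hl
  · rw [cgfExt_of_notMem hl, EReal.sub_top]; exact bot_le

theorem lt_legendre {j : ℝ} {r : ℝ} (h : (r : EReal) < legendre (cgfExt βL βR) j) :
    ∃ lam ∈ Set.Ioo (-βR) βL, r < lam * j - cgf βL βR lam := by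
  by_contra! hc
  exact absurd (legendre_le fun l hl => EReal.coe_le_coe_iff.2 (hc l hl)) (not_le.2 h)

theorem zero_mem (hL : 0 < βL) (hR : 0 < βR) : (0 : ℝ) ∈ Set.Ioo (-βR) βL := ⟨by linarith, hL⟩

theorem legendre_nonneg (hL : 0 < βL) (hR : 0 < βR) (j : ℝ) :
    0 ≤ legendre (cgfExt βL βR) j := by
  have := le_legendre (zero_mem hL hR) j
  rwa [cgf_eq_zero hL hR (zero_mem hL hR) (by simp), zero_mul, sub_zero] at this

theorem lowerSemicontinuous_legendre : LowerSemicontinuous (legendre (cgfExt βL βR)) := by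
  refine lowerSemicontinuous_iSup fun lam => Continuous.lowerSemicontinuous ?_
  by_cases hl : lam ∈ Set.Ioo (-βR) βL
  · simp only [cgfExt_of_mem hl, ← EReal.coe_sub]
    exact continuous_coe_real_ereal.comp (by fun_prop)
  · simp only [cgfExt_of_notMem hl, EReal.sub_top]
    exact continuous_const

/-- For j between 0 and j*, lam j ≤ max 0 (lam j*), and both terms are at most `cgf` lam. -/
theorem legendre_eq_zero (hL : 0 < βL) (hR : 0 < βR) {j : ℝ}
    (hj : j ∈ Set.uIcc 0 (meanCurrent βL βR)) : legendre (cgfExt βL βR) j = 0 := by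
  refine le_antisymm (legendre_le fun lam hlam => ?_) (legendre_nonneg hL hR j)
  have h1 := mul_meanCurrent_le_cgf hL hR hlam
  have h2 := cgf_nonneg βL βR lam
  have : lam * j ≤ max 0 (lam * meanCurrent βL βR) := by
    rcases Set.mem_uIcc.1 hj with ⟨h3, h4⟩ | ⟨h3, h4⟩ <;> rcases le_total 0 lam with h5 | h5
    · exact le_max_of_le_right (mul_le_mul_of_nonneg_left h4 h5)
    · exact le_max_of_le_left (mul_nonpos_of_nonpos_of_nonneg h5 h3)
    · exact le_max_of_le_left (mul_nonpos_of_nonneg_of_nonpos h5 h4)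
    · exact le_max_of_le_right (mul_le_mul_of_nonpos_left h3 h5)
  have : lam * j - cgf βL βR lam ≤ 0 := by linarith [this.trans (max_le h2 h1)]
  exact_mod_cast this

/-- The fluctuation relation `I j = (βL - βR) j + I (-j)`, in the case `I (-j) = 0`. -/
theorem legendre_le_of_legendre_neg_eq_zero {j : ℝ} (h : legendre (cgfExt βL βR) (-j) = 0) :
    legendre (cgfExt βL βR) j ≤ (((βL - βR) * j : ℝ) : EReal) := by
  refine legendre_le fun lam hlam => EReal.coe_le_coe_iff.2 ?_
  have := le_legendre (βL := βL) (βR := βR) (lam := βL - βR - lam)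
    ⟨by linarith [hlam.2], by linarith [hlam.1]⟩ (-j)
  rw [h, cgf_symm] at this
  have h' : (βL - βR - lam) * -j - cgf βL βR lam ≤ 0 := by exact_mod_cast this
  linarith

theorem legendre_eq_abs (hL : 0 < βL) (hR : 0 < βR) {j : ℝ}
    (hj : j ∈ Set.uIcc (-meanCurrent βL βR) 0) :
    legendre (cgfExt βL βR) j = ((|βR - βL| * |j| : ℝ) : EReal) := by
  have hneg : -j ∈ Set.uIcc 0 (meanCurrent βL βR) := by
    rcases Set.mem_uIcc.1 hj with ⟨h1, h2⟩ | ⟨h1, h2⟩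
    · exact Set.mem_uIcc.2 (Or.inl ⟨by linarith, by linarith⟩)
    · exact Set.mem_uIcc.2 (Or.inr ⟨by linarith, by linarith⟩)
  have hκ : 0 < conductivity βL βR := by unfold conductivity; positivity
  have hsign : |βR - βL| * |j| = (βL - βR) * j := by
    have hT : meanCurrent βL βR = conductivity βL βR / (βL * βR) * (βR - βL) := by
      rw [meanCurrent]; field_simp
    have hκ' : 0 < conductivity βL βR / (βL * βR) := by positivity
    rcases Set.mem_uIcc.1 hj with ⟨h1, h2⟩ | ⟨h1, h2⟩
    · have : 0 ≤ βR - βL := nonneg_of_mul_nonneg_right (hT ▸ by linarith) hκ'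
      rw [abs_of_nonneg this, abs_of_nonpos h2]; ring
    · have : βR - βL ≤ 0 := nonpos_of_mul_nonpos_right (hT ▸ by linarith) hκ'
      rw [abs_of_nonpos this, abs_of_nonneg h1]; ring
  rw [hsign]
  refine le_antisymm (legendre_le_of_legendre_neg_eq_zero (legendre_eq_zero hL hR hneg)) ?_
  -- The supremum is attained at lam = βL - βR, the other end of the zero segment of `cgf`.
  have hd : βL - βR ∈ Set.Ioo (-βR) βL := ⟨by linarith, by linarith⟩
  have := le_legendre hd j
  rwa [cgf_eq_zero hL hR hd (by simp), sub_zero] at this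

end Legendre

/-! ### The limit of the scaled cumulants and the large deviations bounds -/

section Law

variable {Ω : Type*} [MeasurableSpace Ω] {P : Measure Ω}
  {βL βR q₀ p₀ : ℝ} {τ : ℕ → Ω → ℝ}

theorem IsTracer.tendsto_scaledCGF (h : IsTracer P βL βR p₀ τ) [IsProbabilityMeasure P]
    (hL : 0 < βL) (hR : 0 < βR)
    (hq : q₀ ∈ Set.Icc (0 : ℝ) 1) (hp : p₀ ≠ 0) (lam : ℝ) :
    Tendsto (fun t : ℝ => scaledCGF P q₀ p₀ τ lam t) atTop (𝓝 (cgfExt βL βR lam)) := by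
  by_cases hlam : lam ∈ Set.Ioo (-βR) βL
  · rw [cgfExt_of_mem hlam]
    refine tendsto_order.2 ⟨fun a ha => ?_, fun a ha => ?_⟩
    · obtain ⟨b, hab, hb⟩ := EReal.lt_iff_exists_real_btwn.1 ha
      have hb' : b < cgf βL βR lam := by exact_mod_cast hb
      filter_upwards [h.eventually_le_lintegral_exp_current hL hR hq hp hlam (sub_pos.2 hb'),
        eventually_gt_atTop 0] with t ht ht0
      rw [sub_sub_cancel] at ht
      exact hab.trans_le (le_log_div ht0 ht)
    · obtain ⟨b, hb, hab⟩ := EReal.lt_iff_exists_real_btwn.1 ha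
      have hb' : cgf βL βR lam < b := by exact_mod_cast hb
      filter_upwards [h.eventually_lintegral_exp_current_le hL hR hq hp hlam hb' 1
        ENNReal.one_ne_top, eventually_gt_atTop 0] with t ht ht0
      rw [one_mul] at ht
      exact (log_div_le ht0 ht).trans_lt hab
  · rw [cgfExt_of_notMem hlam]
    refine tendsto_const_nhds.congr' ?_
    filter_upwards [eventually_gt_atTop (max 1 (firstHit q₀ p₀))] with t ht
    have ht0 : 0 < t := by linarith [(le_max_left 1 (firstHit q₀ p₀)).trans_lt ht]
    rw [scaledCGF, h.lintegral_exp_current_eq_top hL hR hq hp hlam ht, ENNReal.log_top,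
      EReal.top_div_of_pos_ne_top (by exact_mod_cast ht0) (EReal.coe_ne_top t)]

theorem IsTracer.currentLaw_apply (h : IsTracer P βL βR p₀ τ) (hL : 0 < βL) (hR : 0 < βR)
    (hp : p₀ ≠ 0) (t : ℝ) {A : Set ℝ} (hA : MeasurableSet A) :
    currentLaw P q₀ p₀ τ t A = P {ω | current q₀ p₀ τ t ω / t ∈ A} :=
  Measure.map_apply_of_aemeasurable ((h.aemeasurable_current hL hR hp t).div_const t) hA

theorem IsTracer.le_liminf (h : IsTracer P βL βR p₀ τ) [IsProbabilityMeasure P]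
    (hL : 0 < βL) (hR : 0 < βR)
    (hq : q₀ ∈ Set.Icc (0 : ℝ) 1) (hp : p₀ ≠ 0) {A : Set ℝ} (hA : MeasurableSet A) :
    -⨅ x ∈ interior A, legendre (cgfExt βL βR) x ≤
      liminf (fun t : ℝ => ENNReal.log (currentLaw P q₀ p₀ τ t A) / (t : EReal)) atTop := by
  rw [EReal.neg_le]
  refine le_iInf₂ fun x hx => ?_
  obtain ⟨lam, hlam, hloc⟩ := h.exists_eventually_current_near (q₀ := q₀) hL hR hq hp x
  refine le_trans ?_ (le_legendre hlam x)
  -- A single lam bounding the local cost is enough: its value lam x - `cgf` lam is at most I(x).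
  obtain ⟨ρ, hρ, hball⟩ := Metric.isOpen_iff.1 isOpen_interior x hx
  refine EReal.le_of_forall_lt_iff_le.1 fun r hr => ?_
  have hr' : lam * x - cgf βL βR lam < r := by exact_mod_cast hr
  rw [EReal.neg_le, ← EReal.coe_neg]
  refine le_liminf_of_le (by isBoundedDefault) ?_
  filter_upwards [hloc ρ hρ r hr', eventually_gt_atTop 0] with t ht ht0
  refine le_log_div ht0 ?_
  rw [neg_mul, h.currentLaw_apply hL hR hp t hA]
  refine ht.trans (measure_mono fun ω hω => interior_subset (s := A) (hball ?_))
  have hω' : |current q₀ p₀ τ t ω - x * t| < ρ * t := hω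
  rw [Metric.mem_ball, Real.dist_eq]
  have : current q₀ p₀ τ t ω / t - x = (current q₀ p₀ τ t ω - x * t) / t := by field_simp
  rwa [this, abs_div, abs_of_pos ht0, div_lt_iff₀ ht0]

/-- Since r ≥ 0 and `cgf` ≥ 0, a lam with r < lam x - `cgf` lam has the sign of x. Thus the points
farther from 0 than x on the same side lie in the half-line of Chernoff's bound at x. -/
theorem IsTracer.eventually_measure_beyond_le (h : IsTracer P βL βR p₀ τ) (hL : 0 < βL)
    (hR : 0 < βR) (hq : q₀ ∈ Set.Icc (0 : ℝ) 1) (hp : p₀ ≠ 0) {x r : ℝ} (hr : 0 ≤ r)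
    (hx : (r : EReal) < legendre (cgfExt βL βR) x) {S : Set ℝ} (hS : ∀ y ∈ S, 0 ≤ x * (y - x)) :
    ∀ᶠ t in atTop, P {ω | current q₀ p₀ τ t ω / t ∈ S} ≤
      ENNReal.ofReal (Real.exp (-r * t)) / 2 := by
  obtain ⟨lam, hlam, hlt⟩ := lt_legendre hx
  filter_upwards [h.eventually_measure_le hL hR hq hp hlam hlt, eventually_gt_atTop 0] with t ht ht0
  rw [ENNReal.le_div_iff_mul_le (by simp) (by simp), mul_comm, neg_mul]
  refine le_trans (mul_le_mul_right (measure_mono fun ω hω => ?_) _) ht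
  have hlx : 0 < lam * x := by linarith [cgf_nonneg βL βR lam]
  have hx2 : 0 < x ^ 2 := by
    have : x ≠ 0 := fun h0 => by simp [h0] at hlx
    positivity
  have h1 := mul_nonneg hlx.le (hS _ hω)
  have h2 : 0 ≤ lam * (current q₀ p₀ τ t ω / t - x) :=
    nonneg_of_mul_nonneg_right (by linarith : 0 ≤ x ^ 2 * _) hx2
  have h3 := mul_nonneg h2 ht0.le
  have h4 : lam * (current q₀ p₀ τ t ω / t - x) * t = lam * current q₀ p₀ τ t ω - lam * x * t := by
    field_simp
  change lam * x * t ≤ lam * current q₀ p₀ τ t ω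
  linarith

theorem IsTracer.limsup_le (h : IsTracer P βL βR p₀ τ) [IsProbabilityMeasure P]
    (hL : 0 < βL) (hR : 0 < βR) (hq : q₀ ∈ Set.Icc (0 : ℝ) 1) (hp : p₀ ≠ 0) {A : Set ℝ}
    (hA : MeasurableSet A) :
    limsup (fun t : ℝ => ENNReal.log (currentLaw P q₀ p₀ τ t A) / (t : EReal)) atTop ≤
      -⨅ x ∈ closure A, legendre (cgfExt βL βR) x := by
  rw [EReal.le_neg]
  refine EReal.ge_of_forall_gt_iff_ge.1 fun r hr => ?_
  rw [EReal.le_neg, ← EReal.coe_neg]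
  refine limsup_le_of_le (by isBoundedDefault) ?_
  suffices hev : ∀ᶠ t : ℝ in atTop, P {ω | current q₀ p₀ τ t ω / t ∈ A} ≤
      ENNReal.ofReal (Real.exp (-r * t)) by
    filter_upwards [hev, eventually_gt_atTop 0] with t ht ht0
    refine log_div_le ht0 ?_
    rwa [h.currentLaw_apply hL hR hp t hA]
  rcases lt_or_ge r 0 with hr0 | hr0
  · filter_upwards [eventually_gt_atTop 0] with t ht0
    refine prob_le_one.trans (ENNReal.one_le_ofReal.2 (Real.one_le_exp ?_))
    exact mul_nonneg (by linarith) ht0.le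
  have hI : ∀ x ∈ closure A, (r : EReal) < legendre (cgfExt βL βR) x := fun x hx =>
    hr.trans_le (iInf₂_le x hx)
  -- The nonnegative part of the closure lies beyond its infimum, which belongs to the closed set
  -- and so has rate above r. No compactness or exponential tightness is involved.
  have hpos : ∀ᶠ t : ℝ in atTop, P {ω | current q₀ p₀ τ t ω / t ∈ closure A ∩ Set.Ici 0} ≤
      ENNReal.ofReal (Real.exp (-r * t)) / 2 := by
    rcases (closure A ∩ Set.Ici 0).eq_empty_or_nonempty with he | hne
    · simp [he]
    · have hbdd : BddBelow (closure A ∩ Set.Ici 0) := ⟨0, fun y hy => hy.2⟩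
      have hmem := (isClosed_closure.inter isClosed_Ici).csInf_mem hne hbdd
      exact h.eventually_measure_beyond_le hL hR hq hp hr0 (hI _ hmem.1) fun y hy =>
        mul_nonneg hmem.2 (sub_nonneg.2 (csInf_le hbdd hy))
  have hneg : ∀ᶠ t : ℝ in atTop, P {ω | current q₀ p₀ τ t ω / t ∈ closure A ∩ Set.Iic 0} ≤
      ENNReal.ofReal (Real.exp (-r * t)) / 2 := by
    rcases (closure A ∩ Set.Iic 0).eq_empty_or_nonempty with he | hne
    · simp [he]
    · have hbdd : BddAbove (closure A ∩ Set.Iic 0) := ⟨0, fun y hy => hy.2⟩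
      have hmem := (isClosed_closure.inter isClosed_Iic).csSup_mem hne hbdd
      exact h.eventually_measure_beyond_le hL hR hq hp hr0 (hI _ hmem.1) fun y hy =>
        mul_nonneg_of_nonpos_of_nonpos hmem.2 (sub_nonpos.2 (le_csSup hbdd hy))
  filter_upwards [hpos, hneg] with t h1 h2
  calc P {ω | current q₀ p₀ τ t ω / t ∈ A}
      ≤ P ({ω | current q₀ p₀ τ t ω / t ∈ closure A ∩ Set.Ici 0} ∪
          {ω | current q₀ p₀ τ t ω / t ∈ closure A ∩ Set.Iic 0}) := by
        refine measure_mono fun ω hω => ?_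
        rcases le_total 0 (current q₀ p₀ τ t ω / t) with h0 | h0
        · exact Or.inl ⟨subset_closure hω, h0⟩
        · exact Or.inr ⟨subset_closure hω, h0⟩
    _ ≤ _ := measure_union_le _ _
    _ ≤ _ := add_le_add h1 h2
    _ = _ := ENNReal.add_halves _

end Law

end ConfinedTracer

end

theorem mainTheorem1 (βL βR : ℝ) (hL : 0 < βL) (hR : 0 < βR) :
    ∃ f : ℝ → EReal, ConfinedTracer.IsCGF.{u} βL βR f ∧
      (∀ (Ω : Type u) [MeasurableSpace Ω] (P : Measure Ω) [IsProbabilityMeasure P] (q₀ p₀ : ℝ)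
        (τ : ℕ → Ω → ℝ), q₀ ∈ Set.Icc (0 : ℝ) 1 → p₀ ≠ 0 →
        ConfinedTracer.IsTracer P βL βR p₀ τ →
        ConfinedTracer.LargeDeviations (ConfinedTracer.currentLaw P q₀ p₀ τ)
          (ConfinedTracer.legendre f)) ∧
      (∀ j ∈ Set.uIcc 0 (ConfinedTracer.meanCurrent βL βR), ConfinedTracer.legendre f j = 0) ∧
      (∀ j ∈ Set.uIcc (-ConfinedTracer.meanCurrent βL βR) 0,
        ConfinedTracer.legendre f j = ((|βR - βL| * |j| : ℝ) : EReal)) := by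
  refine ⟨ConfinedTracer.cgfExt βL βR, ?_, ?_, fun j hj => ConfinedTracer.legendre_eq_zero hL hR hj,
    fun j hj => ConfinedTracer.legendre_eq_abs hL hR hj⟩
  · intro Ω _ P _ q₀ p₀ τ hq hp h lam
    exact h.tendsto_scaledCGF hL hR hq hp lam
  · intro Ω _ P _ q₀ p₀ τ hq hp h
    exact ⟨ConfinedTracer.legendre_nonneg hL hR, ConfinedTracer.lowerSemicontinuous_legendre,
      fun A hA => h.limsup_le hL hR hq hp hA, fun A hA => h.le_liminf hL hR hq hp hA⟩
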